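/- For each $n\ge 1$ let $G_n$ be an $n\times n$ random matrix with i.i.d. standard Gaussian entries. For $1\le r<\infty$ let $\|x\|_r=(\sum_i|x_i|^r)^{1/r}$, let $\|x\|_\infty=\max_i|x_i|$, and for $1\le p,q\le\infty$ let $\|A\|_{p\to q}=\sup_{\|x\|_p=1}\|Ax\|_q$. Let $p^*$ denote the Hölder conjugate of $p$, i.e. $1/p+1/p^*=1$ (with $1/\infty=0$). For $1\le r<\infty$ let $\xi_r=(\mathbb{E}|z|^r)^{1/r}$, where $z$ is a standard Gaussian variable, and for $1\le a,b\le\infty$ let $\mathfrak{p}(a,b)=(1/a-1/2)_++1/b$. Then $\|G_n\|_{p\to q}$ is integrable for all $1\le p,q\le\infty$ and all $n$, and the following limits hold. (i) For $p=1$ and $1\le q<\infty$, $$\lim_{n\to\infty}n^{-1/q}\,\mathbb{E}\|G_n\|_{p\to q}=\xi_q.$$ (ii) For $1<p\le\infty$ and $q=\infty$, $$\lim_{n\to\infty}n^{-1/p^*}\,\mathbb{E}\|G_n\|_{p\to q}=\xi_{p^*}.$$ (iii) For $1<p\le\infty$ and $1\le q<\infty$, if $\mathfrak{p}(q,p^*)\ne\mathfrak{p}(p^*,q)$,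 then $$\lim_{n\to\infty}n^{-\max(\mathfrak{p}(q,p^*),\,\mathfrak{p}(p^*,q))}\,\mathbb{E}\|G_n\|_{p\to q}=\begin{cases}\xi_{p^*},&\text{if }\mathfrak{p}(q,p^*)>\mathfrak{p}(p^*,q),\\ \xi_q,&\text{if }\mathfrak{p}(q,p^*)<\mathfrak{p}(p^*,q).\end{cases}$$ -/

import Mathlib

open MeasureTheory ProbabilityTheory Filter Topology
open scoped ENNReal Matrix

/-- The `p`-to-`q` operator norm `‖A‖_{p → q} = sup_{‖x‖_p = 1} ‖A x‖_q` of a real `n × n` matrix,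
for `1 ≤ p, q ≤ ∞`. The norm on `PiLp r` is the (unnormalized) `ℓ_r`-norm. -/
noncomputable def matrixOpNorm {n : ℕ} (p q : ℝ≥0∞) (A : Matrix (Fin n) (Fin n) ℝ) : ℝ :=
  ⨆ x : {x : PiLp p (fun _ : Fin n => ℝ) // ‖x‖ = 1}, ‖WithLp.toLp q (A *ᵥ WithLp.ofLp x.1)‖

/-- `ξ_r = (𝔼 |z|^r)^(1/r)` for a standard Gaussian variable `z`; used only for `1 ≤ r < ∞`. -/
noncomputable def gaussianXi (r : ℝ≥0∞) : ℝ :=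
  (∫ z : ℝ, |z| ^ r.toReal ∂gaussianReal 0 1) ^ (1 / r.toReal)

/-- The exponent `𝔭(a, b) = (1/a - 1/2)₊ + 1/b`, for `1 ≤ a, b ≤ ∞` and with `1/∞ = 0`. -/
noncomputable def chevetExponent (a b : ℝ≥0∞) : ℝ :=
  max ((a⁻¹).toReal - 1 / 2) 0 + (b⁻¹).toReal

/-- The random `n × n` matrix `G` has i.i.d. standard Gaussian entries under `P`. -/
structure IsStdGaussianMatrix {n : ℕ} {Ω : Type*} [MeasurableSpace Ω]
    (G : Ω → Matrix (Fin n) (Fin n) ℝ) (P : Measure Ω) : Prop where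
  /-- Each entry is a standard Gaussian random variable. -/
  hasLaw : ∀ i j, HasLaw (fun ω => G ω i j) (gaussianReal 0 1) P
  /-- All `n²` entries are jointly independent. -/
  indep : iIndepFun (fun (ij : Fin n × Fin n) ω => G ω ij.1 ij.2) P

/-!
By duality, `‖G‖_{p → q}` is the supremum of the Gaussian process `⟨y, G x⟩` over
`‖x‖_p ≤ 1`, `‖y‖_{q*} ≤ 1`. Comparing its increments with those of `R ⟨y, g⟩ + Q ⟨x, h⟩`, where
`R` and `Q` are the Euclidean radii of the balls of `x` and of `y`, the Sudakov–Fernique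
inequality gives Chevet's bound `E ‖G‖_{p → q} ≤ R E ‖g‖_q + Q E ‖h‖_{p*}`. Each summand alone is
a lower bound: freeze one variable at a point of maximal Euclidean norm. Since
`R = n^{(1/p* - 1/2)₊}`, `Q = n^{(1/q - 1/2)₊}` and `E ‖g‖_r ∼ ξ_r n^{1/r}` for `r < ∞`, the
summands have orders `n^{𝔭(p*, q)}` and `n^{𝔭(q, p*)}`, and the larger one dominates.

For the Sudakov–Fernique inequality, replace the maximum by `F x = β⁻¹ log ∑ exp (β xᵢ)`, and write
each Gaussian vector as a sum of `2^m` independent copies of itself scaled by `2^{-m/2}`. By a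
second-order expansion of `F`, exchanging one copy costs at most `O(2^{-3m/2})` beyond the
comparison of increments, so exchanging all of them costs `O(2^{-m/2})`.
-/

section CumulantExpansion

variable {ι : Type*} [Fintype ι] {p : ι → ℝ}

theorem abs_sum_mul_le_of_sum_eq_one (hp : ∀ i, 0 ≤ p i) (hp1 : ∑ i, p i = 1) {f : ι → ℝ} {M : ℝ}
    (hf : ∀ i, |f i| ≤ M) : |∑ i, p i * f i| ≤ M :=
  calc |∑ i, p i * f i| ≤ ∑ i, |p i * f i| := Finset.abs_sum_le_sum_abs _ _
    _ ≤ ∑ i, p i * M := Finset.sum_le_sum fun i _ => by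
        rw [abs_mul, abs_of_nonneg (hp i)]
        exact mul_le_mul_of_nonneg_left (hf i) (hp i)
    _ = M := by rw [← Finset.sum_mul, hp1, one_mul]

theorem abs_log_sum_mul_exp_le (hp : ∀ i, 0 ≤ p i) (hp1 : ∑ i, p i = 1) {u : ι → ℝ} {M : ℝ}
    (hu : ∀ i, |u i| ≤ M) : |Real.log (∑ i, p i * Real.exp (u i))| ≤ M := by
  have lower : Real.exp (-M) ≤ ∑ i, p i * Real.exp (u i) :=
    calc Real.exp (-M) = ∑ i, p i * Real.exp (-M) := by rw [← Finset.sum_mul, hp1, one_mul]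
      _ ≤ _ := Finset.sum_le_sum fun i _ =>
          mul_le_mul_of_nonneg_left (Real.exp_le_exp.2 (neg_le_of_abs_le (hu i))) (hp i)
  have upper : ∑ i, p i * Real.exp (u i) ≤ Real.exp M :=
    calc _ ≤ ∑ i, p i * Real.exp M := Finset.sum_le_sum fun i _ =>
          mul_le_mul_of_nonneg_left (Real.exp_le_exp.2 (le_of_abs_le (hu i))) (hp i)
      _ = Real.exp M := by rw [← Finset.sum_mul, hp1, one_mul]
  have pos := (Real.exp_pos (-M)).trans_le lower
  exact abs_le.2 ⟨(Real.le_log_iff_exp_le pos).2 lower, (Real.log_le_iff_le_exp pos).2 upper⟩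

theorem sum_mul_sq_sub_sq_sum_mul (hp1 : ∑ i, p i = 1) (x : ι → ℝ) :
    ∑ i, p i * (x i - ∑ j, p j * x j) ^ 2 = (∑ i, ∑ j, p i * p j * (x i - x j) ^ 2) / 2 := by
  set m := ∑ j, p j * x j with hm
  have centred : ∑ i, p i * (x i - m) ^ 2 = ∑ i, p i * x i ^ 2 - m ^ 2 :=
    calc ∑ i, p i * (x i - m) ^ 2
        = ∑ i, p i * x i ^ 2 - 2 * m * ∑ i, p i * x i + (∑ i, p i) * m ^ 2 := by
          rw [Finset.mul_sum, Finset.sum_mul, ← Finset.sum_sub_distrib, ← Finset.sum_add_distrib]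
          exact Finset.sum_congr rfl fun i _ => by ring
      _ = ∑ i, p i * x i ^ 2 - m ^ 2 := by rw [hp1, ← hm]; ring
  have pairs : ∑ i, ∑ j, p i * p j * (x i - x j) ^ 2 =
      (∑ i, p i * x i ^ 2) * (∑ j, p j) + (∑ i, p i) * (∑ j, p j * x j ^ 2) - 2 * (m * m) := by
    rw [hm, Finset.sum_mul_sum, Finset.sum_mul_sum, Finset.sum_mul_sum]
    simp only [Finset.mul_sum, ← Finset.sum_add_distrib, ← Finset.sum_sub_distrib]
    exact Finset.sum_congr rfl fun i _ => Finset.sum_congr rfl fun j _ => by ring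
  rw [centred, pairs, hp1]
  ring

theorem one_le_sum_mul_exp (hp : ∀ i, 0 ≤ p i) (hp1 : ∑ i, p i = 1) {c : ι → ℝ}
    (hpc : ∑ i, p i * c i = 0) : 1 ≤ ∑ i, p i * Real.exp (c i) :=
  calc 1 = ∑ i, p i * (c i + 1) := by
        simp only [mul_add, Finset.sum_add_distrib, hpc, mul_one, hp1, zero_add]
    _ ≤ ∑ i, p i * Real.exp (c i) := Finset.sum_le_sum fun i _ =>
        mul_le_mul_of_nonneg_left (Real.add_one_le_exp _) (hp i)

theorem abs_log_sum_mul_exp_sub_le_of_centred (hp : ∀ i, 0 ≤ p i) (hp1 : ∑ i, p i = 1)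
    {c : ι → ℝ} (hpc : ∑ i, p i * c i = 0) {N : ℝ} (hN : 0 ≤ N) (hc : ∀ i, |c i| ≤ N) :
    |Real.log (∑ i, p i * Real.exp (c i)) - (∑ i, p i * c i ^ 2) / 2| ≤ 2 * N ^ 3 := by
  set v := ∑ i, p i * c i ^ 2 with hv
  have hvN : |v| ≤ N ^ 2 := abs_sum_mul_le_of_sum_eq_one hp hp1 fun i => by
    rw [abs_pow]
    exact pow_le_pow_left₀ (abs_nonneg _) (hc i) 2
  rcases le_or_gt N 1 with hN1 | hN1
  · obtain ⟨d, hd⟩ : ∃ d, d = ∑ i, p i * Real.exp (c i) - 1 := ⟨_, rfl⟩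
    have taylor : |d - v / 2| ≤ N ^ 3 * (2 / 9) := by
      have : d - v / 2 = ∑ i, p i * (Real.exp (c i) - (1 + c i + c i ^ 2 / 2)) := by
        simp only [hd, hv, mul_sub, mul_add, Finset.sum_sub_distrib, Finset.sum_add_distrib,
          mul_one, hp1, hpc, Finset.sum_div, mul_div_assoc]
        ring
      rw [this]
      refine abs_sum_mul_le_of_sum_eq_one hp hp1 fun i => ?_
      have := Real.exp_bound ((hc i).trans hN1) (n := 3) (by norm_num)
      norm_num [Finset.sum_range_succ, Nat.factorial] at this
      exact this.trans (by gcongr; exact hc i)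
    have d_nonneg : 0 ≤ d := by linarith [one_le_sum_mul_exp hp hp1 hpc]
    have d_sq_le : d ^ 2 ≤ N ^ 3 := by
      have : d ≤ N ^ 2 := by nlinarith [abs_le.1 taylor, abs_le.1 hvN, pow_nonneg hN 2]
      calc d ^ 2 ≤ (N ^ 2) ^ 2 := pow_le_pow_left₀ d_nonneg this 2
        _ = N ^ 3 * N := by ring
        _ ≤ N ^ 3 := mul_le_of_le_one_right (pow_nonneg hN 3) hN1
    have log_le : Real.log (1 + d) ≤ d := by
      linarith [Real.log_le_sub_one_of_pos (show 0 < 1 + d by linarith)]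
    have le_log : d - d ^ 2 ≤ Real.log (1 + d) := by
      refine le_trans ?_ (Real.one_sub_inv_le_log_of_pos (by linarith))
      field_simp
      nlinarith [pow_nonneg d_nonneg 3]
    rw [show ∑ i, p i * Real.exp (c i) = 1 + d by rw [hd]; ring, abs_le]
    constructor <;> linarith [abs_le.1 taylor, pow_nonneg hN 3]
  · have hlog := abs_le.1 (abs_log_sum_mul_exp_le hp hp1 hc)
    have le_cube : N ≤ N ^ 3 := le_self_pow₀ hN1.le (by norm_num)
    have sq_le_cube : N ^ 2 ≤ N ^ 3 := pow_le_pow_right₀ hN1.le (by norm_num)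
    rw [abs_le]
    constructor <;> linarith [abs_le.1 hvN]

theorem abs_log_sum_mul_exp_sub_le (hp : ∀ i, 0 ≤ p i) (hp1 : ∑ i, p i = 1) {u : ι → ℝ}
    {M : ℝ} (hM : 0 ≤ M) (hu : ∀ i, |u i| ≤ M) :
    |Real.log (∑ i, p i * Real.exp (u i)) - (∑ i, p i * u i +
      (∑ i, ∑ j, p i * p j * (u i - u j) ^ 2) / 4)| ≤ 16 * M ^ 3 := by
  set m := ∑ i, p i * u i with hm
  have hmM : |m| ≤ M := abs_sum_mul_le_of_sum_eq_one hp hp1 hu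
  have centred : ∑ i, p i * (u i - m) = 0 := by
    simp only [mul_sub, Finset.sum_sub_distrib, ← Finset.sum_mul, hp1, one_mul, ← hm, sub_self]
  have bound : ∀ i, |u i - m| ≤ 2 * M := fun i => (abs_sub _ _).trans (by linarith [hu i])
  have factor : ∑ i, p i * Real.exp (u i) = Real.exp m * ∑ i, p i * Real.exp (u i - m) := by
    rw [Finset.mul_sum]
    refine Finset.sum_congr rfl fun i _ => ?_
    rw [mul_left_comm, ← Real.exp_add, add_sub_cancel]
  have pos : 0 < ∑ i, p i * Real.exp (u i - m) :=
    one_pos.trans_le (one_le_sum_mul_exp hp hp1 centred)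
  have h := abs_log_sum_mul_exp_sub_le_of_centred hp hp1 centred (by linarith) bound
  rw [sum_mul_sq_sub_sq_sum_mul hp1] at h
  rw [factor, Real.log_mul (Real.exp_pos m).ne' pos.ne', Real.log_exp,
    show 16 * M ^ 3 = 2 * (2 * M) ^ 3 by ring]
  convert h using 2
  ring

end CumulantExpansion

section LogSumExp

variable {ι : Type*} [Fintype ι]

/-- The function `log ∑ exp zᵢ`, a smooth substitute for the maximum of the `zᵢ`. -/
noncomputable def logSumExp (z : ι → ℝ) : ℝ := Real.log (∑ i, Real.exp (z i))

/-- The Gibbs weights `exp zᵢ / ∑ⱼ exp zⱼ`, which are the partial derivatives of `logSumExp`. -/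
noncomputable def softmax (z : ι → ℝ) (i : ι) : ℝ := Real.exp (z i) / ∑ j, Real.exp (z j)

theorem softmax_nonneg (z : ι → ℝ) (i : ι) : 0 ≤ softmax z i :=
  div_nonneg (Real.exp_pos _).le (Finset.sum_nonneg fun _ _ => (Real.exp_pos _).le)

variable [Nonempty ι]

theorem sum_exp_pos (z : ι → ℝ) : 0 < ∑ i, Real.exp (z i) :=
  Finset.sum_pos (fun _ _ => Real.exp_pos _) Finset.univ_nonempty

theorem sum_softmax (z : ι → ℝ) : ∑ i, softmax z i = 1 := by
  simp only [softmax, ← Finset.sum_div, div_self (sum_exp_pos z).ne']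

theorem iSup_le_logSumExp (z : ι → ℝ) : ⨆ i, z i ≤ logSumExp z :=
  ciSup_le fun i => (Real.le_log_iff_exp_le (sum_exp_pos z)).2 <|
    Finset.single_le_sum (f := fun i => Real.exp (z i)) (fun _ _ => (Real.exp_pos _).le)
      (Finset.mem_univ i)

theorem logSumExp_le_iSup_add (z : ι → ℝ) :
    logSumExp z ≤ (⨆ i, z i) + Real.log (Fintype.card ι) := by
  have card_pos : (0 : ℝ) < Fintype.card ι := by exact_mod_cast Fintype.card_pos
  rw [logSumExp, Real.log_le_iff_le_exp (sum_exp_pos z), Real.exp_add, Real.exp_log card_pos]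
  calc ∑ i, Real.exp (z i) ≤ ∑ _i : ι, Real.exp (⨆ i, z i) :=
        Finset.sum_le_sum fun i _ => Real.exp_le_exp.2 (le_ciSup (Set.finite_range z).bddAbove i)
    _ = Real.exp (⨆ i, z i) * Fintype.card ι := by simp [mul_comm]

theorem logSumExp_add (z u : ι → ℝ) :
    logSumExp (z + u) = logSumExp z + Real.log (∑ i, softmax z i * Real.exp (u i)) := by
  have : ∑ i, softmax z i * Real.exp (u i) =
      (∑ i, Real.exp ((z + u) i)) / ∑ j, Real.exp (z j) := by
    rw [Finset.sum_div]
    exact Finset.sum_congr rfl fun i _ => by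
      rw [softmax, Pi.add_apply, Real.exp_add, div_mul_eq_mul_div]
  rw [this, Real.log_div (sum_exp_pos _).ne' (sum_exp_pos z).ne', logSumExp, logSumExp,
    add_sub_cancel]

theorem lipschitzWith_logSumExp : LipschitzWith 1 (logSumExp : (ι → ℝ) → ℝ) :=
  LipschitzWith.of_dist_le_mul fun x y => by
    rw [NNReal.coe_one, one_mul, Real.dist_eq, dist_eq_norm, ← add_sub_cancel y x, logSumExp_add,
      add_sub_cancel_left, add_sub_cancel]
    exact abs_log_sum_mul_exp_le (softmax_nonneg y) (sum_softmax y) (norm_le_pi_norm (x - y))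

theorem abs_logSumExp_add_smul_sub_le (z x : ι → ℝ) {r : ℝ} (hr : 0 ≤ r) :
    |logSumExp (z + r • x) - (logSumExp z + r * ∑ i, softmax z i * x i +
      r ^ 2 / 4 * ∑ i, ∑ j, softmax z i * softmax z j * (x i - x j) ^ 2)|
      ≤ r ^ 3 * (16 * ‖x‖ ^ 3) := by
  have hu : ∀ i, |(r • x) i| ≤ r * ‖x‖ := fun i => by
    rw [Pi.smul_apply, smul_eq_mul, abs_mul, abs_of_nonneg hr]
    exact mul_le_mul_of_nonneg_left (norm_le_pi_norm x i) hr
  have h := abs_log_sum_mul_exp_sub_le (softmax_nonneg z) (sum_softmax z) (by positivity) hu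
  have linear : ∑ i, softmax z i * (r • x) i = r * ∑ i, softmax z i * x i := by
    rw [Finset.mul_sum]
    exact Finset.sum_congr rfl fun i _ => mul_left_comm _ _ _
  have quadratic : ∑ i, ∑ j, softmax z i * softmax z j * ((r • x) i - (r • x) j) ^ 2 =
      r ^ 2 * ∑ i, ∑ j, softmax z i * softmax z j * (x i - x j) ^ 2 := by
    simp only [Finset.mul_sum, Pi.smul_apply, smul_eq_mul]
    exact Finset.sum_congr rfl fun i _ => Finset.sum_congr rfl fun j _ => by ring
  rw [linear, quadratic] at h
  rw [logSumExp_add, show r ^ 3 * (16 * ‖x‖ ^ 3) = 16 * (r * ‖x‖) ^ 3 by ring]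
  convert h using 2
  ring

end LogSumExp

section GaussianComparison

variable {E : Type*} [NormedAddCommGroup E] {F : E → ℝ} {K : NNReal}

theorem integrable_comp_of_lipschitzWith {Ω : Type*} [MeasurableSpace Ω] {P : Measure Ω}
    [IsFiniteMeasure P] (hF : LipschitzWith K F) {X : Ω → E} (hX : Integrable X P) :
    Integrable (fun ω => F (X ω)) P := by
  refine ((integrable_const |F 0|).add (hX.norm.const_mul K)).mono'
    (hF.continuous.comp_aestronglyMeasurable hX.1) (.of_forall fun ω => ?_)
  have h := hF.dist_le_mul (X ω) 0
  rw [Real.dist_eq, dist_zero_right] at h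
  have : |F (X ω)| ≤ |F 0| + |F (X ω) - F 0| := by
    simpa only [add_sub_cancel] using abs_add_le (F 0) (F (X ω) - F 0)
  exact this.trans (add_le_add_right h _)

variable [MeasurableSpace E] [BorelSpace E] [SecondCountableTopology E]

theorem integrable_id_conv {μ ν : Measure E} [IsFiniteMeasure μ] [IsFiniteMeasure ν]
    (hμ : Integrable id μ) (hν : Integrable id ν) : Integrable id (μ ∗ ν) :=
  (integrable_map_measure aestronglyMeasurable_id (by fun_prop)).2
    ((hμ.comp_fst ν).add (hν.comp_snd μ))

theorem integral_add_conv_le {ρ μ ν : Measure E} [IsProbabilityMeasure ρ] [IsProbabilityMeasure μ]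
    [IsProbabilityMeasure ν] (hF : LipschitzWith K F) (hρ : Integrable id ρ) (hμ : Integrable id μ)
    (hν : Integrable id ν) {c : ℝ}
    (h : ∀ z, ∫ x, F (z + x) ∂μ ≤ ∫ x, F (z + x) ∂ν + c) (z : E) :
    ∫ x, F (z + x) ∂(ρ ∗ μ) ≤ ∫ x, F (z + x) ∂(ρ ∗ ν) + c := by
  have integrable_translate : ∀ σ : Measure E, IsFiniteMeasure σ → Integrable id σ →
      Integrable (fun x => F (z + x)) σ := fun σ _ hσ =>
    integrable_comp_of_lipschitzWith hF ((integrable_const z).add hσ)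
  have integrable_inner : ∀ σ : Measure E, IsProbabilityMeasure σ → Integrable id σ →
      Integrable (fun x => ∫ y, F (z + (x + y)) ∂σ) ρ := fun σ _ hσ =>
    ((integrable_map_measure (integrable_translate _ inferInstance
      (integrable_id_conv hρ hσ)).1 (by fun_prop)).1
        (integrable_translate _ inferInstance (integrable_id_conv hρ hσ))).integral_prod_left
  rw [integral_conv (integrable_translate _ inferInstance (integrable_id_conv hρ hμ)),
    integral_conv (integrable_translate _ inferInstance (integrable_id_conv hρ hν))]
  calc ∫ x, ∫ y, F (z + (x + y)) ∂μ ∂ρ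
      ≤ ∫ x, (∫ y, F (z + (x + y)) ∂ν + c) ∂ρ :=
        integral_mono (integrable_inner μ inferInstance hμ)
          ((integrable_inner ν inferInstance hν).add (integrable_const c)) fun x => by
            simpa only [add_assoc] using h (z + x)
    _ = ∫ x, ∫ y, F (z + (x + y)) ∂ν ∂ρ + c := by
        rw [integral_add (integrable_inner ν inferInstance hν) (integrable_const c)]
        simp

theorem integral_add_conv_self_le {μ ν : Measure E} [IsProbabilityMeasure μ]
    [IsProbabilityMeasure ν] (hF : LipschitzWith K F) (hμ : Integrable id μ)
    (hν : Integrable id ν) {c : ℝ}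
    (h : ∀ z, ∫ x, F (z + x) ∂μ ≤ ∫ x, F (z + x) ∂ν + c) (z : E) :
    ∫ x, F (z + x) ∂(μ ∗ μ) ≤ ∫ x, F (z + x) ∂(ν ∗ ν) + 2 * c :=
  calc ∫ x, F (z + x) ∂(μ ∗ μ) ≤ ∫ x, F (z + x) ∂(μ ∗ ν) + c :=
        integral_add_conv_le hF hμ hμ hν h z
    _ = ∫ x, F (z + x) ∂(ν ∗ μ) + c := by rw [Measure.conv_comm]
    _ ≤ ∫ x, F (z + x) ∂(ν ∗ ν) + c + c := by
        gcongr
        exact integral_add_conv_le hF hν hμ hν h z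
    _ = ∫ x, F (z + x) ∂(ν ∗ ν) + 2 * c := by ring

variable [NormedSpace ℝ E] [CompleteSpace E] {μ ν : Measure E} [IsGaussian μ] [IsGaussian ν]

theorem conv_self_of_isGaussian (hμ : μ[id] = 0) : μ ∗ μ = μ.map (fun x => √2 • x) := by
  have rotated_fst : (μ.prod μ).map (fun w => (√2 / 2) • w.1 + (√2 / 2) • w.2) = μ := by
    have h := congrArg (Measure.map Prod.fst) (IsGaussian.map_rotation_eq_self hμ (Real.pi / 4))
    rw [Measure.map_map (by fun_prop) (by fun_prop), Measure.map_fst_prod, measure_univ,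
      one_smul] at h
    simpa [Function.comp_def, ContinuousLinearMap.rotation_apply] using h
  have sqrt_two_mul_half : √2 * (√2 / 2) = (1 : ℝ) := by
    rw [← mul_div_assoc, Real.mul_self_sqrt (by norm_num), div_self two_ne_zero]
  conv_rhs => rw [← rotated_fst]
  rw [Measure.conv, Measure.map_map (by fun_prop) (by fun_prop)]
  congr 1
  ext w
  simp only [Function.comp_apply, smul_add, smul_smul, sqrt_two_mul_half, one_smul]

theorem integral_add_sqrt_two_mul_smul_le (hF : LipschitzWith K F) (hμ : μ[id] = 0)
    (hν : ν[id] = 0) {r c : ℝ}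
    (h : ∀ z, ∫ x, F (z + r • x) ∂μ ≤ ∫ x, F (z + r • x) ∂ν + c) (z : E) :
    ∫ x, F (z + (√2 * r) • x) ∂μ ≤ ∫ x, F (z + (√2 * r) • x) ∂ν + 2 * c := by
  have integral_map_smul : ∀ (ρ : Measure E) (s : ℝ) (z : E),
      ∫ x, F (z + x) ∂(ρ.map (s • ·)) = ∫ x, F (z + s • x) ∂ρ := fun ρ s z =>
    integral_map (by fun_prop) (hF.continuous.comp (by fun_prop)).aestronglyMeasurable
  have integrable_map_smul : ∀ ρ : Measure E, IsGaussian ρ → Integrable id (ρ.map (r • ·)) :=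
    fun ρ _ => (integrable_map_measure aestronglyMeasurable_id (by fun_prop)).2
      (IsGaussian.integrable_id.smul r)
  have conv_map_smul : ∀ ρ : Measure E, IsGaussian ρ → ρ[id] = 0 →
      ρ.map (r • ·) ∗ ρ.map (r • ·) = ρ.map ((√2 * r) • ·) := fun ρ _ hρ => by
    have := Measure.map_conv_continuousLinearMap (μ := ρ) (ν := ρ)
      (r • ContinuousLinearMap.id ℝ E)
    rw [conv_self_of_isGaussian hρ, Measure.map_map (by fun_prop) (by fun_prop)] at this
    simpa [Function.comp_def, Pi.smul_def, smul_smul, mul_comm] using this.symm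
  have : IsProbabilityMeasure (μ.map (r • ·)) := Measure.isProbabilityMeasure_map (by fun_prop)
  have : IsProbabilityMeasure (ν.map (r • ·)) := Measure.isProbabilityMeasure_map (by fun_prop)
  have := integral_add_conv_self_le hF (integrable_map_smul μ inferInstance)
    (integrable_map_smul ν inferInstance)
    (by simpa only [integral_map_smul] using h) z
  rwa [conv_map_smul μ inferInstance hμ, conv_map_smul ν inferInstance hν, integral_map_smul,
    integral_map_smul] at this

theorem integral_add_le_of_small_scale (hF : LipschitzWith K F) (hμ : μ[id] = 0)
    (hν : ν[id] = 0) {C : ℝ}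
    (h : ∀ z, ∀ r ≥ 0, ∫ x, F (z + r • x) ∂μ ≤ ∫ x, F (z + r • x) ∂ν + r ^ 3 * C) (z : E) :
    ∫ x, F (z + x) ∂μ ≤ ∫ x, F (z + x) ∂ν := by
  obtain ⟨s, hs⟩ : ∃ s : ℝ, s = (√2)⁻¹ := ⟨_, rfl⟩
  have s_pos : 0 < s := by rw [hs]; positivity
  have sqrt_two_mul : √2 * s = 1 := by rw [hs]; exact mul_inv_cancel₀ (by positivity)
  have s_sq : 2 * s ^ 2 = 1 := by rw [hs, inv_pow, Real.sq_sqrt zero_le_two]; norm_num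
  have s_lt_one : s < 1 := by nlinarith
  have doubling : ∀ (m : ℕ) (c : ℝ),
      (∀ z, ∫ x, F (z + s ^ m • x) ∂μ ≤ ∫ x, F (z + s ^ m • x) ∂ν + c) →
      ∀ z, ∫ x, F (z + x) ∂μ ≤ ∫ x, F (z + x) ∂ν + 2 ^ m * c := by
    intro m
    induction m with
    | zero => simp
    | succ m ih =>
      intro c hc z
      have h2 := ih (2 * c) fun z => by
        have := integral_add_sqrt_two_mul_smul_le hF hμ hν hc z
        rwa [show √2 * s ^ (m + 1) = s ^ m by rw [pow_succ', ← mul_assoc, sqrt_two_mul, one_mul]]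
          at this
      rw [pow_succ, mul_assoc]
      exact h2 z
  have bound : ∀ m : ℕ, ∫ x, F (z + x) ∂μ ≤ ∫ x, F (z + x) ∂ν + s ^ m * C := fun m => by
    have : 2 ^ m * ((s ^ m) ^ 3 * C) = s ^ m * C := by
      calc 2 ^ m * ((s ^ m) ^ 3 * C) = (2 * s ^ 2) ^ m * (s ^ m * C) := by
            rw [mul_pow, ← pow_mul, ← pow_mul]; ring
        _ = s ^ m * C := by rw [s_sq, one_pow, one_mul]
    rw [← this]
    exact doubling m _ (fun z => h z _ (pow_nonneg s_pos.le m)) z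
  refine ge_of_tendsto' (x := atTop) ?_ bound
  simpa using ((tendsto_pow_atTop_nhds_zero_of_lt_one s_pos.le s_lt_one).mul_const C).const_add
    (∫ x, F (z + x) ∂ν)

end GaussianComparison

theorem abs_iSup_sub_iSup_le {T : Type*} [Nonempty T] {f g : T → ℝ}
    (hf : BddAbove (Set.range f)) (hg : BddAbove (Set.range g)) {C : ℝ}
    (h : ∀ t, |f t - g t| ≤ C) : |(⨆ t, f t) - ⨆ t, g t| ≤ C := by
  rw [abs_sub_le_iff, sub_le_iff_le_add, sub_le_iff_le_add]
  constructor
  · exact ciSup_le fun t => by linarith [le_ciSup hg t, le_of_abs_le (h t)]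
  · exact ciSup_le fun t => by linarith [le_ciSup hf t, neg_le_of_abs_le (h t)]

section Evaluation

variable {ι : Type*} [Finite ι] {μ : Measure (ι → ℝ)} [IsGaussian μ]

theorem memLp_two_eval_of_isGaussian (i : ι) : MemLp (fun x : ι → ℝ => x i) 2 μ :=
  have := Fintype.ofFinite ι
  IsGaussian.memLp_dual μ (ContinuousLinearMap.proj i) 2 (by simp)

theorem integrable_eval_of_isGaussian (i : ι) : Integrable (fun x : ι → ℝ => x i) μ :=
  have := Fintype.ofFinite ι
  IsGaussian.integrable_dual μ (ContinuousLinearMap.proj i)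

end Evaluation

section SudakovFernique

variable {ι : Type*} [Fintype ι] {μ ν : Measure (ι → ℝ)} [IsGaussian μ] [IsGaussian ν]

theorem integral_eval_eq_zero_of_isGaussian (hμ : μ[id] = 0) (i : ι) : ∫ x, x i ∂μ = 0 := by
  have := IsGaussian.integral_dual (μ := μ) (ContinuousLinearMap.proj (R := ℝ) i)
  simp only [id] at hμ
  rw [hμ] at this
  simpa using this

theorem integrable_and_integral_softmax_expansion (hμ : μ[id] = 0) (z : ι → ℝ) (r : ℝ) :
    let T : (ι → ℝ) → ℝ := fun x => logSumExp z + r * ∑ i, softmax z i * x i +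
      r ^ 2 / 4 * ∑ i, ∑ j, softmax z i * softmax z j * (x i - x j) ^ 2
    Integrable T μ ∧ ∫ x, T x ∂μ = logSumExp z +
      r ^ 2 / 4 * ∑ i, ∑ j, softmax z i * softmax z j * ∫ x, (x i - x j) ^ 2 ∂μ := by
  have integrable_linear : ∀ i, Integrable (fun x : ι → ℝ => softmax z i * x i) μ := fun i =>
    (integrable_eval_of_isGaussian i).const_mul _
  have integrable_quadratic : ∀ i j, Integrable
      (fun x : ι → ℝ => softmax z i * softmax z j * (x i - x j) ^ 2) μ := fun i j =>
    ((memLp_two_eval_of_isGaussian i).sub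
      (memLp_two_eval_of_isGaussian j)).integrable_sq.const_mul _
  have integrable_affine : Integrable
      (fun x : ι → ℝ => logSumExp z + r * ∑ i, softmax z i * x i) μ :=
    (integrable_const _).add ((integrable_finsetSum _ fun i _ => integrable_linear i).const_mul r)
  have integrable_sum_sq : Integrable (fun x : ι → ℝ =>
      r ^ 2 / 4 * ∑ i, ∑ j, softmax z i * softmax z j * (x i - x j) ^ 2) μ :=
    (integrable_finsetSum _ fun i _ => integrable_finsetSum _ fun j _ =>
      integrable_quadratic i j).const_mul _
  refine ⟨integrable_affine.add integrable_sum_sq, ?_⟩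
  rw [integral_add integrable_affine integrable_sum_sq, integral_add (integrable_const _)
    ((integrable_finsetSum _ fun i _ => integrable_linear i).const_mul r), integral_const_mul,
    integral_const_mul, integral_finsetSum _ fun i _ => integrable_linear i,
    integral_finsetSum _ fun i _ => integrable_finsetSum _ fun j _ => integrable_quadratic i j]
  simp only [integral_finsetSum _ fun j _ => integrable_quadratic _ j, integral_const_mul,
    integral_eval_eq_zero_of_isGaussian hμ, mul_zero, Finset.sum_const_zero, add_zero,
    integral_const, probReal_univ, one_smul]

variable [Nonempty ι]

theorem abs_integral_logSumExp_add_smul_sub_le (hμ : μ[id] = 0) (z : ι → ℝ) {r : ℝ} (hr : 0 ≤ r) :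
    |∫ x, logSumExp (z + r • x) ∂μ - (logSumExp z +
      r ^ 2 / 4 * ∑ i, ∑ j, softmax z i * softmax z j * ∫ x, (x i - x j) ^ 2 ∂μ)|
      ≤ r ^ 3 * (16 * ∫ x, ‖x‖ ^ 3 ∂μ) := by
  obtain ⟨hT, hT_eq⟩ := integrable_and_integral_softmax_expansion hμ z r
  have hL : Integrable (fun x => logSumExp (z + r • x)) μ :=
    integrable_comp_of_lipschitzWith lipschitzWith_logSumExp
      ((integrable_const z).add (IsGaussian.integrable_id.smul r))
  have hN : Integrable (fun x : ι → ℝ => ‖x‖ ^ 3) μ := by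
    simpa using (IsGaussian.memLp_id μ 3 (by simp)).integrable_norm_pow'
  rw [← hT_eq, ← integral_sub hL hT, ← integral_const_mul, ← integral_const_mul]
  exact abs_integral_le_integral_abs.trans
    (integral_mono (hL.sub hT).abs ((hN.const_mul _).const_mul _)
      fun x => abs_logSumExp_add_smul_sub_le z x hr)

theorem integral_logSumExp_smul_le (hμ : μ[id] = 0) (hν : ν[id] = 0)
    (h : ∀ i j, ∫ x, (x i - x j) ^ 2 ∂μ ≤ ∫ x, (x i - x j) ^ 2 ∂ν) {β : ℝ} (hβ : 0 ≤ β) :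
    ∫ x, logSumExp (β • x) ∂μ ≤ ∫ x, logSumExp (β • x) ∂ν := by
  have lipschitz : LipschitzWith (1 * ‖β‖₊) fun x : ι → ℝ => logSumExp (β • x) :=
    lipschitzWith_logSumExp.comp (lipschitzWith_smul β)
  have small_scale : ∀ z : ι → ℝ, ∀ r ≥ 0,
      ∫ x, logSumExp (β • (z + r • x)) ∂μ ≤ ∫ x, logSumExp (β • (z + r • x)) ∂ν +
        r ^ 3 * (β ^ 3 * (16 * ∫ x, ‖x‖ ^ 3 ∂μ + 16 * ∫ x, ‖x‖ ^ 3 ∂ν)) := by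
    intro z r hr
    have hμr := abs_le.1 (abs_integral_logSumExp_add_smul_sub_le hμ (β • z) (mul_nonneg hβ hr))
    have hνr := abs_le.1 (abs_integral_logSumExp_add_smul_sub_le hν (β • z) (mul_nonneg hβ hr))
    have quadratic : (β * r) ^ 2 / 4 * ∑ i, ∑ j, softmax (β • z) i * softmax (β • z) j *
        ∫ x, (x i - x j) ^ 2 ∂μ ≤ (β * r) ^ 2 / 4 * ∑ i, ∑ j, softmax (β • z) i *
        softmax (β • z) j * ∫ x, (x i - x j) ^ 2 ∂ν := by
      refine mul_le_mul_of_nonneg_left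
        (Finset.sum_le_sum fun i _ => Finset.sum_le_sum fun j _ => ?_) (by positivity)
      exact mul_le_mul_of_nonneg_left (h i j) (mul_nonneg (softmax_nonneg _ _) (softmax_nonneg _ _))
    simp only [smul_add, smul_smul]
    linarith [hμr.2, hνr.1]
  simpa using integral_add_le_of_small_scale lipschitz hμ hν small_scale 0

theorem lipschitzWith_iSup : LipschitzWith 1 fun x : ι → ℝ => ⨆ i, x i :=
  LipschitzWith.of_dist_le_mul fun x y => by
    rw [NNReal.coe_one, one_mul, Real.dist_eq]
    exact abs_iSup_sub_iSup_le (Set.finite_range x).bddAbove (Set.finite_range y).bddAbove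
      fun i => dist_le_pi_dist x y i

theorem integral_iSup_le_of_integral_sq_sub_le (hμ : μ[id] = 0) (hν : ν[id] = 0)
    (h : ∀ i j, ∫ x, (x i - x j) ^ 2 ∂μ ≤ ∫ x, (x i - x j) ^ 2 ∂ν) :
    ∫ x, ⨆ i, x i ∂μ ≤ ∫ x, ⨆ i, x i ∂ν := by
  have integrable_iSup : ∀ ρ : Measure (ι → ℝ), IsGaussian ρ →
      Integrable (fun x => ⨆ i, x i) ρ := fun ρ _ =>
    integrable_comp_of_lipschitzWith lipschitzWith_iSup IsGaussian.integrable_id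
  have integrable_logSumExp : ∀ (β : ℝ) (ρ : Measure (ι → ℝ)), IsGaussian ρ →
      Integrable (fun x => logSumExp (β • x)) ρ := fun β ρ _ =>
    integrable_comp_of_lipschitzWith lipschitzWith_logSumExp (IsGaussian.integrable_id.smul β)
  have approx : ∀ β : ℝ, 0 < β → ∫ x, ⨆ i, x i ∂μ ≤
      ∫ x, ⨆ i, x i ∂ν + β⁻¹ * Real.log (Fintype.card ι) := by
    intro β hβ
    have iSup_smul : ∀ x : ι → ℝ, ⨆ i, (β • x) i = β * ⨆ i, x i := fun x =>
      (Real.mul_iSup_of_nonneg hβ.le x).symm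
    have := calc β * ∫ x, ⨆ i, x i ∂μ = ∫ x, β * ⨆ i, x i ∂μ := (integral_const_mul _ _).symm
      _ ≤ ∫ x, logSumExp (β • x) ∂μ :=
          integral_mono ((integrable_iSup μ inferInstance).const_mul β)
            (integrable_logSumExp β μ inferInstance) fun x =>
              (iSup_smul x).symm.trans_le (iSup_le_logSumExp _)
      _ ≤ ∫ x, logSumExp (β • x) ∂ν := integral_logSumExp_smul_le hμ hν h hβ.le
      _ ≤ ∫ x, (β * (⨆ i, x i) + Real.log (Fintype.card ι)) ∂ν :=
          integral_mono (integrable_logSumExp β ν inferInstance)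
            (((integrable_iSup ν inferInstance).const_mul β).add (integrable_const _)) fun x =>
              (logSumExp_le_iSup_add _).trans_eq (by rw [iSup_smul])
      _ = β * ∫ x, ⨆ i, x i ∂ν + Real.log (Fintype.card ι) := by
          rw [integral_add ((integrable_iSup ν inferInstance).const_mul β) (integrable_const _),
            integral_const_mul, integral_const, probReal_univ, one_smul]
    rwa [← mul_le_mul_iff_right₀ hβ, mul_add, mul_inv_cancel_left₀ hβ.ne']
  have limit : Tendsto (fun β : ℝ => ∫ x, ⨆ i, x i ∂ν + β⁻¹ * Real.log (Fintype.card ι)) atTop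
      (𝓝 (∫ x, ⨆ i, x i ∂ν)) := by
    simpa using (tendsto_inv_atTop_zero.mul_const (Real.log (Fintype.card ι))).const_add
      (∫ x, ⨆ i, x i ∂ν)
  exact ge_of_tendsto limit ((eventually_gt_atTop 0).mono approx)

end SudakovFernique

/-- The law of a vector of independent standard Gaussian variables indexed by `κ`. -/
noncomputable abbrev stdGaussianPi (κ : Type*) [Fintype κ] : Measure (κ → ℝ) :=
  Measure.pi fun _ : κ => gaussianReal 0 1

/-- The Gaussian width `E sup_t ⟨a t, g⟩` of a family of vectors, `g` being a standard Gaussian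
vector. It is meaningful for nonempty bounded families. -/
noncomputable def gaussianWidth {T κ : Type*} [Fintype κ] (a : T → κ → ℝ) : ℝ :=
  ∫ g, ⨆ t, a t ⬝ᵥ g ∂stdGaussianPi κ

section GaussianWidth

variable {κ κ' T T' : Type*} [Fintype κ] [Fintype κ']

instance isGaussian_stdGaussianPi : IsGaussian (stdGaussianPi κ) := by
  have h : HasGaussianLaw (fun (g : κ → ℝ) i => g i) (stdGaussianPi κ) :=
    iIndepFun.hasGaussianLaw
      (fun i => ((measurePreserving_eval (fun _ : κ => gaussianReal 0 1) i).hasLaw).hasGaussianLaw)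
      (iIndepFun_pi (X := fun _ x => x) fun _ => aemeasurable_id)
  simpa using h.isGaussian_map

theorem integral_eval_stdGaussianPi (k : κ) : ∫ g, g k ∂stdGaussianPi κ = 0 :=
  (integral_comp_eval (μ := fun _ : κ => gaussianReal 0 1) (i := k)
    (f := fun x : ℝ => x) (by fun_prop)).trans integral_id_gaussianReal

theorem integral_id_stdGaussianPi : (stdGaussianPi κ)[id] = 0 := by
  ext k
  have h := IsGaussian.integral_dual (μ := stdGaussianPi κ) (ContinuousLinearMap.proj (R := ℝ) k)
  simpa using h.symm.trans (integral_eval_stdGaussianPi k)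

theorem integral_sq_dotProduct_stdGaussianPi (c : κ → ℝ) :
    ∫ g, (c ⬝ᵥ g) ^ 2 ∂stdGaussianPi κ = c ⬝ᵥ c := by
  have mean : ∫ g, c ⬝ᵥ g ∂stdGaussianPi κ = 0 := by
    simp only [dotProduct]
    rw [integral_finsetSum _ fun k _ => (integrable_eval_of_isGaussian k).const_mul _]
    simp only [integral_const_mul, integral_eval_stdGaussianPi, mul_zero, Finset.sum_const_zero]
  have variance : Var[∑ k, fun g : κ → ℝ => c k * g k; stdGaussianPi κ] =
      ∑ k, Var[fun x => c k * x; gaussianReal 0 1] :=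
    variance_sum_pi fun k => (memLp_id_gaussianReal' 2 (by simp)).const_mul (c k)
  have sum_eq : (∑ k, fun g : κ → ℝ => c k * g k) = fun g => c ⬝ᵥ g := by
    ext g
    simp only [Finset.sum_apply, dotProduct]
  have measurable_dotProduct : Measurable fun g : κ → ℝ => c ⬝ᵥ g :=
    Finset.measurable_fun_sum _ fun k _ => measurable_const.mul (measurable_pi_apply k)
  rw [sum_eq, variance_eq_integral measurable_dotProduct.aemeasurable, mean] at variance
  simp only [sub_zero] at variance
  refine variance.trans (Finset.sum_congr rfl fun k _ => ?_)
  rw [variance_const_mul, variance_fun_id_gaussianReal, NNReal.coe_one, mul_one, sq]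

theorem abs_dotProduct_le (v g : κ → ℝ) : |v ⬝ᵥ g| ≤ Fintype.card κ * ‖v‖ * ‖g‖ :=
  calc |v ⬝ᵥ g| ≤ ∑ k, |v k * g k| := Finset.abs_sum_le_sum_abs _ _
    _ ≤ ∑ _k : κ, ‖v‖ * ‖g‖ := Finset.sum_le_sum fun k _ => by
        rw [abs_mul]
        exact mul_le_mul (norm_le_pi_norm v k) (norm_le_pi_norm g k) (abs_nonneg _) (norm_nonneg _)
    _ = Fintype.card κ * ‖v‖ * ‖g‖ := by
        rw [Finset.sum_const, Finset.card_univ, nsmul_eq_mul, mul_assoc]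

theorem bddAbove_range_dotProduct {a : T → κ → ℝ} (ha : Bornology.IsBounded (Set.range a))
    (g : κ → ℝ) : BddAbove (Set.range fun t => a t ⬝ᵥ g) := by
  obtain ⟨C, hC⟩ := isBounded_iff_forall_norm_le.1 ha
  refine ⟨Fintype.card κ * C * ‖g‖, Set.forall_mem_range.2 fun t => ?_⟩
  refine (le_of_abs_le (abs_dotProduct_le (a t) g)).trans ?_
  gcongr
  exact hC _ ⟨t, rfl⟩

theorem exists_finite_net {a : T → κ → ℝ} (ha : Bornology.IsBounded (Set.range a)) {δ : ℝ}
    (hδ : 0 < δ) : ∃ S : Finset T, ∀ t, ∃ s ∈ S, ‖a t - a s‖ < δ := by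
  classical
  obtain ⟨N, hN_sub, hN_finite, hN_cover⟩ :=
    Metric.finite_approx_of_totallyBounded
      (ha.isCompact_closure.totallyBounded.subset subset_closure) δ hδ
  lift N to Finset (κ → ℝ) using hN_finite
  rw [← Set.image_univ, Finset.subset_set_image_iff] at hN_sub
  obtain ⟨S, -, rfl⟩ := hN_sub
  refine ⟨S, fun t => ?_⟩
  simpa [dist_eq_norm] using hN_cover ⟨t, rfl⟩

section Nonempty

variable [Nonempty T]

theorem integrable_iSup_dotProduct {a : T → κ → ℝ} (ha : Bornology.IsBounded (Set.range a)) :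
    Integrable (fun g => ⨆ t, a t ⬝ᵥ g) (stdGaussianPi κ) := by
  obtain ⟨C, hC⟩ := isBounded_iff_forall_norm_le.1 ha
  have lipschitz : LipschitzWith (Real.toNNReal (Fintype.card κ * C)) fun g => ⨆ t, a t ⬝ᵥ g := by
    refine LipschitzWith.of_dist_le' fun g g' => ?_
    rw [Real.dist_eq, dist_eq_norm]
    refine abs_iSup_sub_iSup_le (bddAbove_range_dotProduct ha g) (bddAbove_range_dotProduct ha g')
      fun t => ?_
    rw [← dotProduct_sub]
    refine (abs_dotProduct_le _ _).trans ?_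
    gcongr
    exact hC _ ⟨t, rfl⟩
  exact integrable_comp_of_lipschitzWith lipschitz IsGaussian.integrable_id

theorem gaussianWidth_mono {a : T → κ → ℝ} {b : T' → κ → ℝ} [Nonempty T']
    (ha : Bornology.IsBounded (Set.range a)) (hb : Bornology.IsBounded (Set.range b))
    (h : Set.range a ⊆ Set.range b) : gaussianWidth a ≤ gaussianWidth b := by
  refine integral_mono (integrable_iSup_dotProduct ha) (integrable_iSup_dotProduct hb)
    fun g => ciSup_le fun t => ?_
  obtain ⟨t', ht'⟩ := h ⟨t, rfl⟩
  exact ht' ▸ le_ciSup (bddAbove_range_dotProduct hb g) t'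

theorem exists_isGaussian_integral_iSup_eq_gaussianWidth [Fintype T] (a : T → κ → ℝ) :
    ∃ μ : Measure (T → ℝ), IsGaussian μ ∧ μ[id] = 0 ∧
      (∀ s t, ∫ x, (x s - x t) ^ 2 ∂μ = (a s - a t) ⬝ᵥ (a s - a t)) ∧
      ∫ x, ⨆ t, x t ∂μ = gaussianWidth a := by
  let L : (κ → ℝ) →L[ℝ] T → ℝ := (Matrix.mulVecLin (Matrix.of a)).toContinuousLinearMap
  have L_apply : ∀ g t, L g t = a t ⬝ᵥ g := fun _ _ => rfl
  refine ⟨(stdGaussianPi κ).map L, inferInstance, ?_, fun s t => ?_, ?_⟩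
  · exact (L.integral_id_map IsGaussian.integrable_id).trans
      ((congrArg L integral_id_stdGaussianPi).trans (map_zero L))
  · rw [integral_map (by fun_prop) (by fun_prop), ← integral_sq_dotProduct_stdGaussianPi]
    simp only [L_apply, sub_dotProduct]
  · rw [integral_map (by fun_prop) lipschitzWith_iSup.continuous.aestronglyMeasurable]
    rfl

theorem gaussianWidth_le_of_finite [Finite T] (a : T → κ → ℝ) (b : T → κ' → ℝ)
    (h : ∀ s t, (a s - a t) ⬝ᵥ (a s - a t) ≤ (b s - b t) ⬝ᵥ (b s - b t)) :
    gaussianWidth a ≤ gaussianWidth b := by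
  have := Fintype.ofFinite T
  obtain ⟨μ, hμ_gaussian, hμ_mean, hμ_increment, hμ_width⟩ :=
    exists_isGaussian_integral_iSup_eq_gaussianWidth a
  obtain ⟨ν, hν_gaussian, hν_mean, hν_increment, hν_width⟩ :=
    exists_isGaussian_integral_iSup_eq_gaussianWidth b
  rw [← hμ_width, ← hν_width]
  refine integral_iSup_le_of_integral_sq_sub_le hμ_mean hν_mean fun s t => ?_
  rw [hμ_increment, hν_increment]
  exact h s t

theorem gaussianWidth_le_add_of_net {a : T → κ → ℝ} (ha : Bornology.IsBounded (Set.range a))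
    {S : Finset T} {δ : ℝ} (hS : ∀ t, ∃ s ∈ S, ‖a t - a s‖ < δ) :
    gaussianWidth a ≤ gaussianWidth (fun s : S => a s) +
      δ * (Fintype.card κ * ∫ g : κ → ℝ, ‖g‖ ∂stdGaussianPi κ) := by
  obtain ⟨s₀, hs₀, -⟩ := hS (Classical.arbitrary T)
  have : Nonempty S := ⟨⟨s₀, hs₀⟩⟩
  have ha_S : Bornology.IsBounded (Set.range fun s : S => a s) := (Set.finite_range _).isBounded
  have iSup_le : ∀ g, ⨆ t, a t ⬝ᵥ g ≤ (⨆ s : S, a s ⬝ᵥ g) + δ * (Fintype.card κ * ‖g‖) := by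
    refine fun g => ciSup_le fun t => ?_
    obtain ⟨s, hs, hts⟩ := hS t
    calc a t ⬝ᵥ g = a s ⬝ᵥ g + (a t - a s) ⬝ᵥ g := by rw [sub_dotProduct, add_sub_cancel]
      _ ≤ (⨆ s : S, a s ⬝ᵥ g) + Fintype.card κ * ‖a t - a s‖ * ‖g‖ :=
          add_le_add (le_ciSup (bddAbove_range_dotProduct ha_S g) ⟨s, hs⟩)
            (le_of_abs_le (abs_dotProduct_le _ _))
      _ ≤ (⨆ s : S, a s ⬝ᵥ g) + Fintype.card κ * δ * ‖g‖ := by gcongr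
      _ = _ := by ring
  have integrable_error : Integrable (fun g : κ → ℝ => δ * (Fintype.card κ * ‖g‖))
      (stdGaussianPi κ) := (IsGaussian.integrable_id.norm.const_mul _).const_mul δ
  rw [← integral_const_mul, ← integral_const_mul]
  exact (integral_mono (integrable_iSup_dotProduct ha)
    ((integrable_iSup_dotProduct ha_S).add integrable_error) iSup_le).trans_eq
      (integral_add (integrable_iSup_dotProduct ha_S) integrable_error)

theorem gaussianWidth_le {a : T → κ → ℝ} {b : T → κ' → ℝ}
    (ha : Bornology.IsBounded (Set.range a)) (hb : Bornology.IsBounded (Set.range b))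
    (h : ∀ s t, (a s - a t) ⬝ᵥ (a s - a t) ≤ (b s - b t) ⬝ᵥ (b s - b t)) :
    gaussianWidth a ≤ gaussianWidth b := by
  set C := Fintype.card κ * ∫ g : κ → ℝ, ‖g‖ ∂stdGaussianPi κ
  have net_bound : ∀ δ > 0, gaussianWidth a ≤ gaussianWidth b + δ * C := by
    intro δ hδ
    obtain ⟨S, hS⟩ := exists_finite_net ha hδ
    obtain ⟨s₀, hs₀, -⟩ := hS (Classical.arbitrary T)
    have : Nonempty S := ⟨⟨s₀, hs₀⟩⟩
    calc gaussianWidth a ≤ gaussianWidth (fun s : S => a s) + δ * C :=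
          gaussianWidth_le_add_of_net ha hS
      _ ≤ gaussianWidth (fun s : S => b s) + δ * C := by
          gcongr 1
          exact gaussianWidth_le_of_finite _ _ fun s t => h s t
      _ ≤ gaussianWidth b + δ * C := by
          gcongr 1
          exact gaussianWidth_mono (Set.finite_range _).isBounded hb
            (Set.range_comp_subset_range Subtype.val b)
  have limit : Tendsto (fun δ => gaussianWidth b + δ * C) (𝓝[>] 0) (𝓝 (gaussianWidth b)) := by
    have : Continuous fun δ : ℝ => gaussianWidth b + δ * C := by fun_prop
    simpa using (this.tendsto 0).mono_left nhdsWithin_le_nhds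
  exact ge_of_tendsto limit (eventually_mem_nhdsWithin.mono net_bound)

end Nonempty

end GaussianWidth

section Chevet

variable {κ ι S T : Type*} [Fintype κ] [Fintype ι]

/-- The elementary tensor `y ⊗ x`; pairing it with the entries of a matrix `G` gives
`⟨y, G x⟩`. -/
def tensorVec (y : κ → ℝ) (x : ι → ℝ) : κ × ι → ℝ := fun k => y k.1 * x k.2

theorem dotProduct_tensorVec (y y' : κ → ℝ) (x x' : ι → ℝ) :
    tensorVec y x ⬝ᵥ tensorVec y' x' = (y ⬝ᵥ y') * (x ⬝ᵥ x') := by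
  simp only [dotProduct, tensorVec, Finset.sum_mul_sum, Fintype.sum_prod_type]
  exact Finset.sum_congr rfl fun i _ => Finset.sum_congr rfl fun j _ => by ring

theorem isBounded_range_of_dotProduct_self_le {a : T → κ → ℝ} {C : ℝ}
    (h : ∀ t, a t ⬝ᵥ a t ≤ C) : Bornology.IsBounded (Set.range a) := by
  refine isBounded_iff_forall_norm_le.2 ⟨√C, Set.forall_mem_range.2 fun t => ?_⟩
  refine (pi_norm_le_iff_of_nonneg (Real.sqrt_nonneg C)).2 fun k => Real.abs_le_sqrt ?_
  rw [sq]
  exact (Finset.single_le_sum (f := fun k => a t k * a t k) (fun k _ => mul_self_nonneg _)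
    (Finset.mem_univ k)).trans (h t)

theorem dotProduct_le_sqrt_mul_sqrt (y y' : κ → ℝ) : y ⬝ᵥ y' ≤ √(y ⬝ᵥ y) * √(y' ⬝ᵥ y') := by
  simpa only [dotProduct, sq] using Real.sum_mul_le_sqrt_mul_sqrt Finset.univ y y'

theorem dotProduct_le_sq {R : ℝ} (hR : 0 ≤ R) {x x' : ι → ℝ} (hx : x ⬝ᵥ x ≤ R ^ 2)
    (hx' : x' ⬝ᵥ x' ≤ R ^ 2) : x ⬝ᵥ x' ≤ R ^ 2 := by
  rw [sq]
  exact (dotProduct_le_sqrt_mul_sqrt x x').trans (mul_le_mul (Real.sqrt_le_iff.2 ⟨hR, hx⟩)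
    (Real.sqrt_le_iff.2 ⟨hR, hx'⟩) (Real.sqrt_nonneg _) hR)

theorem mul_gaussianWidth_le [Nonempty T] {R : ℝ} (hR : 0 ≤ R) {a : T → κ → ℝ} {b : T → ι → ℝ}
    (ha : Bornology.IsBounded (Set.range a)) (hb : Bornology.IsBounded (Set.range b))
    (h : ∀ s t, R ^ 2 * ((a s - a t) ⬝ᵥ (a s - a t)) ≤ (b s - b t) ⬝ᵥ (b s - b t)) :
    R * gaussianWidth a ≤ gaussianWidth b := by
  have smul_bdd : Bornology.IsBounded (Set.range fun t => R • a t) :=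
    Set.smul_set_range (a := R) a ▸ ha.smul₀ R
  have smul_width : gaussianWidth (fun t => R • a t) = R * gaussianWidth a := by
    simp only [gaussianWidth, smul_dotProduct, smul_eq_mul, ← Real.mul_iSup_of_nonneg hR,
      integral_const_mul]
  rw [← smul_width]
  refine gaussianWidth_le smul_bdd hb fun s t => (le_of_eq ?_).trans (h s t)
  rw [← smul_sub, smul_dotProduct, dotProduct_smul, smul_eq_mul, smul_eq_mul, ← mul_assoc, sq]

theorem integral_iSup_dotProduct_comp [Nonempty T] {a : T → κ → ℝ}
    (ha : Bornology.IsBounded (Set.range a)) {φ : (ι → ℝ) → κ → ℝ}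
    (hφ : MeasurePreserving φ (stdGaussianPi ι) (stdGaussianPi κ)) :
    Integrable (fun g => ⨆ t, a t ⬝ᵥ φ g) (stdGaussianPi ι) ∧
      ∫ g, ⨆ t, a t ⬝ᵥ φ g ∂stdGaussianPi ι = gaussianWidth a := by
  have integrable := integrable_iSup_dotProduct ha
  refine ⟨hφ.integrable_comp_of_integrable integrable, ?_⟩
  rw [gaussianWidth, ← hφ.map_eq, integral_map hφ.aemeasurable]
  exact hφ.map_eq.symm ▸ integrable.aestronglyMeasurable

theorem measurePreserving_comp_inl :
    MeasurePreserving (fun g : κ ⊕ ι → ℝ => g ∘ Sum.inl) (stdGaussianPi (κ ⊕ ι))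
      (stdGaussianPi κ) :=
  measurePreserving_fst.comp
    (measurePreserving_sumPiEquivProdPi (X := fun _ : κ ⊕ ι => ℝ) fun _ => gaussianReal 0 1)

theorem measurePreserving_comp_inr :
    MeasurePreserving (fun g : κ ⊕ ι → ℝ => g ∘ Sum.inr) (stdGaussianPi (κ ⊕ ι))
      (stdGaussianPi ι) :=
  measurePreserving_snd.comp
    (measurePreserving_sumPiEquivProdPi (X := fun _ : κ ⊕ ι => ℝ) fun _ => gaussianReal 0 1)

/-- The vector `(R y, |y| x)`, whose increments dominate those of `y ⊗ x` as long as
`|x| ≤ R`. -/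
noncomputable def chevetVec (R : ℝ) (y : κ → ℝ) (x : ι → ℝ) : κ ⊕ ι → ℝ :=
  Sum.elim (R • y) (√(y ⬝ᵥ y) • x)

theorem chevetVec_dotProduct (R : ℝ) (y : κ → ℝ) (x : ι → ℝ) (g : κ ⊕ ι → ℝ) :
    chevetVec R y x ⬝ᵥ g = R * (y ⬝ᵥ g ∘ Sum.inl) + √(y ⬝ᵥ y) * (x ⬝ᵥ g ∘ Sum.inr) := by
  conv_lhs => rw [← Sum.elim_comp_inl_inr g]
  rw [chevetVec, sumElim_dotProduct_sumElim, smul_dotProduct, smul_dotProduct, smul_eq_mul,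
    smul_eq_mul]

theorem tensorVec_sub_dotProduct_self_le {R : ℝ} (hR : 0 ≤ R) (y y' : κ → ℝ) {x x' : ι → ℝ}
    (hx : x ⬝ᵥ x ≤ R ^ 2) (hx' : x' ⬝ᵥ x' ≤ R ^ 2) :
    (tensorVec y x - tensorVec y' x') ⬝ᵥ (tensorVec y x - tensorVec y' x') ≤
      (chevetVec R y x - chevetVec R y' x') ⬝ᵥ (chevetVec R y x - chevetVec R y' x') := by
  have hs : √(y ⬝ᵥ y) ^ 2 = y ⬝ᵥ y :=
    Real.sq_sqrt (Finset.sum_nonneg fun k _ => mul_self_nonneg (y k))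
  have hs' : √(y' ⬝ᵥ y') ^ 2 = y' ⬝ᵥ y' :=
    Real.sq_sqrt (Finset.sum_nonneg fun k _ => mul_self_nonneg (y' k))
  have excess_nonneg : 0 ≤ 2 * ((R ^ 2 - x ⬝ᵥ x') * (√(y ⬝ᵥ y) * √(y' ⬝ᵥ y') - y ⬝ᵥ y')) +
      R ^ 2 * (√(y ⬝ᵥ y) - √(y' ⬝ᵥ y')) ^ 2 :=
    add_nonneg (mul_nonneg zero_le_two (mul_nonneg (sub_nonneg.2 (dotProduct_le_sq hR hx hx'))
      (sub_nonneg.2 (dotProduct_le_sqrt_mul_sqrt y y')))) (by positivity)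
  simp only [chevetVec, sub_dotProduct, dotProduct_sub, dotProduct_tensorVec,
    sumElim_dotProduct_sumElim, smul_dotProduct, dotProduct_smul, smul_eq_mul,
    dotProduct_comm x' x, dotProduct_comm y' y]
  linear_combination excess_nonneg + (R ^ 2 - x ⬝ᵥ x) * hs + (R ^ 2 - x' ⬝ᵥ x') * hs'

variable {x : S → ι → ℝ} {y : T → κ → ℝ} {R Q : ℝ}

theorem isBounded_range_tensorVec (hx : ∀ s, x s ⬝ᵥ x s ≤ R ^ 2) (hy : ∀ t, y t ⬝ᵥ y t ≤ Q ^ 2) :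
    Bornology.IsBounded (Set.range fun i : T × S => tensorVec (y i.1) (x i.2)) := by
  refine isBounded_range_of_dotProduct_self_le (C := Q ^ 2 * R ^ 2) fun i => ?_
  rw [dotProduct_tensorVec]
  exact mul_le_mul (hy i.1) (hx i.2) (Finset.sum_nonneg fun k _ => mul_self_nonneg _) (sq_nonneg Q)

theorem isBounded_range_chevetVec (hx : ∀ s, x s ⬝ᵥ x s ≤ R ^ 2)
    (hy : ∀ t, y t ⬝ᵥ y t ≤ Q ^ 2) :
    Bornology.IsBounded (Set.range fun i : T × S => chevetVec R (y i.1) (x i.2)) := by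
  refine isBounded_range_of_dotProduct_self_le (C := R ^ 2 * Q ^ 2 + Q ^ 2 * R ^ 2) fun i => ?_
  have hx_nonneg : 0 ≤ x i.2 ⬝ᵥ x i.2 := Finset.sum_nonneg fun k _ => mul_self_nonneg _
  have hy_nonneg : 0 ≤ y i.1 ⬝ᵥ y i.1 := Finset.sum_nonneg fun k _ => mul_self_nonneg _
  calc chevetVec R (y i.1) (x i.2) ⬝ᵥ chevetVec R (y i.1) (x i.2)
      = R ^ 2 * (y i.1 ⬝ᵥ y i.1) + (y i.1 ⬝ᵥ y i.1) * (x i.2 ⬝ᵥ x i.2) := by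
        simp only [chevetVec, sumElim_dotProduct_sumElim, smul_dotProduct, dotProduct_smul,
          smul_eq_mul]
        rw [← mul_assoc, ← mul_assoc, ← sq, Real.mul_self_sqrt hy_nonneg]
    _ ≤ R ^ 2 * Q ^ 2 + Q ^ 2 * R ^ 2 :=
        add_le_add (mul_le_mul_of_nonneg_left (hy i.1) (sq_nonneg R))
          (mul_le_mul (hy i.1) (hx i.2) hx_nonneg (sq_nonneg Q))

variable [Nonempty T]

theorem iSup_chevetVec_dotProduct_le (hR : 0 ≤ R) (hx : ∀ s, x s ⬝ᵥ x s ≤ R ^ 2) (hQ : 0 ≤ Q)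
    (hy : ∀ t, y t ⬝ᵥ y t ≤ Q ^ 2) (hx_zero : ∃ s, x s = 0) (g : κ ⊕ ι → ℝ) :
    ⨆ i : T × S, chevetVec R (y i.1) (x i.2) ⬝ᵥ g ≤
      R * (⨆ t, y t ⬝ᵥ g ∘ Sum.inl) + Q * ⨆ s, x s ⬝ᵥ g ∘ Sum.inr := by
  obtain ⟨s₀, hs₀⟩ := hx_zero
  have : Nonempty S := ⟨s₀⟩
  have le_sup_y := le_ciSup
    (bddAbove_range_dotProduct (isBounded_range_of_dotProduct_self_le hy) (g ∘ Sum.inl))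
  have le_sup_x := le_ciSup
    (bddAbove_range_dotProduct (isBounded_range_of_dotProduct_self_le hx) (g ∘ Sum.inr))
  have sup_x_nonneg : 0 ≤ ⨆ s, x s ⬝ᵥ g ∘ Sum.inr := by
    simpa only [hs₀, zero_dotProduct] using le_sup_x s₀
  refine ciSup_le fun i => ?_
  rw [chevetVec_dotProduct]
  exact add_le_add (mul_le_mul_of_nonneg_left (le_sup_y i.1) hR)
    ((mul_le_mul_of_nonneg_left (le_sup_x i.2) (Real.sqrt_nonneg _)).trans
      (mul_le_mul_of_nonneg_right (Real.sqrt_le_iff.2 ⟨hQ, hy i.1⟩) sup_x_nonneg))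

theorem gaussianWidth_chevetVec_le (hR : 0 ≤ R) (hx : ∀ s, x s ⬝ᵥ x s ≤ R ^ 2) (hQ : 0 ≤ Q)
    (hy : ∀ t, y t ⬝ᵥ y t ≤ Q ^ 2) (hx_zero : ∃ s, x s = 0) :
    gaussianWidth (fun i : T × S => chevetVec R (y i.1) (x i.2)) ≤
      R * gaussianWidth y + Q * gaussianWidth x := by
  have : Nonempty S := hx_zero.nonempty
  obtain ⟨integrable_y, integral_y⟩ := integral_iSup_dotProduct_comp
    (isBounded_range_of_dotProduct_self_le hy) (measurePreserving_comp_inl (ι := ι))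
  obtain ⟨integrable_x, integral_x⟩ := integral_iSup_dotProduct_comp
    (isBounded_range_of_dotProduct_self_le hx) (measurePreserving_comp_inr (κ := κ))
  rw [← integral_y, ← integral_x, ← integral_const_mul, ← integral_const_mul]
  exact (integral_mono (integrable_iSup_dotProduct (isBounded_range_chevetVec hx hy))
    ((integrable_y.const_mul R).add (integrable_x.const_mul Q))
    (iSup_chevetVec_dotProduct_le hR hx hQ hy hx_zero)).trans_eq
    (integral_add (integrable_y.const_mul R) (integrable_x.const_mul Q))

theorem gaussianWidth_tensorVec_le (hR : 0 ≤ R) (hx : ∀ s, x s ⬝ᵥ x s ≤ R ^ 2) (hQ : 0 ≤ Q)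
    (hy : ∀ t, y t ⬝ᵥ y t ≤ Q ^ 2) (hx_zero : ∃ s, x s = 0) :
    gaussianWidth (fun i : T × S => tensorVec (y i.1) (x i.2)) ≤
      R * gaussianWidth y + Q * gaussianWidth x := by
  have : Nonempty S := hx_zero.nonempty
  exact (gaussianWidth_le (isBounded_range_tensorVec hx hy) (isBounded_range_chevetVec hx hy)
    fun i j => tensorVec_sub_dotProduct_self_le hR _ _ (hx i.2) (hx j.2)).trans
    (gaussianWidth_chevetVec_le hR hx hQ hy hx_zero)

theorem mul_gaussianWidth_left_le (hR : 0 ≤ R) (hx : ∀ s, x s ⬝ᵥ x s ≤ R ^ 2)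
    (hy : ∀ t, y t ⬝ᵥ y t ≤ Q ^ 2) (hx_max : ∃ s, x s ⬝ᵥ x s = R ^ 2) :
    R * gaussianWidth y ≤ gaussianWidth (fun i : T × S => tensorVec (y i.1) (x i.2)) := by
  obtain ⟨s, hs⟩ := hx_max
  have : Nonempty S := ⟨s⟩
  have range_subset : Set.range (fun t => tensorVec (y t) (x s)) ⊆
      Set.range fun i : T × S => tensorVec (y i.1) (x i.2) :=
    Set.range_subset_iff.2 fun t => ⟨(t, s), rfl⟩
  have tensor_bdd := isBounded_range_tensorVec hx hy
  refine (mul_gaussianWidth_le hR (isBounded_range_of_dotProduct_self_le hy)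
    (tensor_bdd.subset range_subset) fun t t' => le_of_eq ?_).trans
    (gaussianWidth_mono (tensor_bdd.subset range_subset) tensor_bdd range_subset)
  simp only [sub_dotProduct, dotProduct_sub, dotProduct_tensorVec, hs]
  ring

theorem mul_gaussianWidth_right_le [Nonempty S] (hx : ∀ s, x s ⬝ᵥ x s ≤ R ^ 2) (hQ : 0 ≤ Q)
    (hy : ∀ t, y t ⬝ᵥ y t ≤ Q ^ 2) (hy_max : ∃ t, y t ⬝ᵥ y t = Q ^ 2) :
    Q * gaussianWidth x ≤ gaussianWidth (fun i : T × S => tensorVec (y i.1) (x i.2)) := by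
  obtain ⟨t, ht⟩ := hy_max
  have range_subset : Set.range (fun s => tensorVec (y t) (x s)) ⊆
      Set.range fun i : T × S => tensorVec (y i.1) (x i.2) :=
    Set.range_subset_iff.2 fun s => ⟨(t, s), rfl⟩
  have tensor_bdd := isBounded_range_tensorVec hx hy
  refine (mul_gaussianWidth_le hQ (isBounded_range_of_dotProduct_self_le hx)
    (tensor_bdd.subset range_subset) fun s s' => le_of_eq ?_).trans
    (gaussianWidth_mono (tensor_bdd.subset range_subset) tensor_bdd range_subset)
  simp only [sub_dotProduct, dotProduct_sub, dotProduct_tensorVec, ht]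
  ring

end Chevet

section LpNorm

variable {κ : Type*} [Fintype κ] {r s : ℝ≥0∞}

theorem norm_toLp_rpow_toReal (hr : r ≠ 0) (hr_top : r ≠ ∞) (x : κ → ℝ) :
    ‖WithLp.toLp r x‖ ^ r.toReal = ∑ k, |x k| ^ r.toReal := by
  have hr_pos := ENNReal.toReal_pos hr hr_top
  rw [PiLp.norm_eq_sum hr_pos, ← Real.rpow_mul (Finset.sum_nonneg fun k _ => by positivity),
    one_div_mul_cancel hr_pos.ne', Real.rpow_one]
  rfl

theorem enorm_toLp_eq_eLpNorm_count [MeasurableSpace κ] [MeasurableSingletonClass κ]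
    [Fact (1 ≤ r)] (x : κ → ℝ) : ‖WithLp.toLp r x‖ₑ = eLpNorm x r Measure.count := by
  have hr : r ≠ 0 := (zero_lt_one.trans_le Fact.out).ne'
  rcases eq_or_ne r ∞ with rfl | hr_top
  · rw [eLpNorm_exponent_top, eLpNormEssSup_count, ← ofReal_norm, PiLp.norm_toLp, ofReal_norm,
      enorm_eq_nnnorm, Pi.nnnorm_def, ENNReal.coe_finset_sup, Finset.sup_univ_eq_iSup]
    rfl
  · have hr_pos := ENNReal.toReal_pos hr hr_top
    rw [eLpNorm_eq_lintegral_rpow_enorm_toReal hr hr_top, lintegral_count, tsum_fintype,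
      ← ofReal_norm, PiLp.norm_eq_sum hr_pos, ← ENNReal.ofReal_rpow_of_nonneg
        (Finset.sum_nonneg fun k _ => by positivity) (by positivity),
      ENNReal.ofReal_sum_of_nonneg fun k _ => by positivity]
    congr 1
    refine Finset.sum_congr rfl fun k _ => ?_
    rw [← ENNReal.ofReal_rpow_of_nonneg (norm_nonneg _) hr_pos.le, ofReal_norm]

theorem dotProduct_le_norm_toLp_mul_norm_toLp [ENNReal.HolderConjugate r s] (x y : κ → ℝ) :
    x ⬝ᵥ y ≤ ‖WithLp.toLp r x‖ * ‖WithLp.toLp s y‖ := by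
  let _ : MeasurableSpace κ := ⊤
  have : Fact (1 ≤ r) := ⟨ENNReal.HolderConjugate.one_le r s⟩
  have : Fact (1 ≤ s) := ⟨ENNReal.HolderConjugate.one_le s r⟩
  have holder := eLpNorm_smul_le_mul_eLpNorm (μ := Measure.count) (p := r) (q := s) (r := 1)
    (f := y) (φ := x) measurable_from_top.aestronglyMeasurable
    measurable_from_top.aestronglyMeasurable
  rw [← enorm_toLp_eq_eLpNorm_count, ← enorm_toLp_eq_eLpNorm_count,
    ← enorm_toLp_eq_eLpNorm_count] at holder
  have holder_real := ENNReal.toReal_mono (ENNReal.mul_ne_top (by simp) (by simp)) holder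
  rw [ENNReal.toReal_mul, toReal_enorm, toReal_enorm, toReal_enorm, PiLp.norm_eq_of_L1]
    at holder_real
  exact (Finset.sum_le_sum fun k _ => le_abs_self (x k * y k)).trans holder_real

variable [Fact (1 ≤ r)]

theorem norm_toLp_le_of_abs_le {x y : κ → ℝ} (h : ∀ k, |x k| ≤ |y k|) :
    ‖WithLp.toLp r x‖ ≤ ‖WithLp.toLp r y‖ := by
  let _ : MeasurableSpace κ := ⊤
  rw [← enorm_le_iff_norm_le, enorm_toLp_eq_eLpNorm_count, enorm_toLp_eq_eLpNorm_count]
  exact eLpNorm_mono h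

variable [Fact (1 ≤ s)]

theorem norm_toLp_le_of_exponent_le (hsr : s ≤ r) (x : κ → ℝ) :
    ‖WithLp.toLp r x‖ ≤ ‖WithLp.toLp s x‖ := by
  have apply_le : ∀ k, |x k| ≤ ‖WithLp.toLp s x‖ := PiLp.norm_apply_le (WithLp.toLp s x)
  rcases eq_or_ne r ∞ with rfl | hr_top
  · rw [PiLp.norm_toLp]
    exact (pi_norm_le_iff_of_nonneg (norm_nonneg _)).2 apply_le
  have hr : r ≠ 0 := (zero_lt_one.trans_le Fact.out).ne'
  have hs : s ≠ 0 := (zero_lt_one.trans_le Fact.out).ne'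
  have hs_top : s ≠ ∞ := ne_top_of_le_ne_top hr_top hsr
  have toReal_le : 0 ≤ r.toReal - s.toReal := sub_nonneg.2 (ENNReal.toReal_mono hr_top hsr)
  have split_rpow : ∀ t : ℝ, 0 ≤ t →
      t ^ r.toReal = t ^ s.toReal * t ^ (r.toReal - s.toReal) := fun t ht => by
    rw [← Real.rpow_add_of_nonneg ht ENNReal.toReal_nonneg toReal_le, add_sub_cancel]
  rw [← Real.rpow_le_rpow_iff (norm_nonneg _) (norm_nonneg _) (ENNReal.toReal_pos hr hr_top)]
  calc ‖WithLp.toLp r x‖ ^ r.toReal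
      = ∑ k, |x k| ^ s.toReal * |x k| ^ (r.toReal - s.toReal) := by
        rw [norm_toLp_rpow_toReal hr hr_top]
        exact Finset.sum_congr rfl fun k _ => split_rpow _ (abs_nonneg _)
    _ ≤ ∑ k, |x k| ^ s.toReal * ‖WithLp.toLp s x‖ ^ (r.toReal - s.toReal) := by
        gcongr with k
        exact apply_le k
    _ = ‖WithLp.toLp s x‖ ^ r.toReal := by
        rw [← Finset.sum_mul, ← norm_toLp_rpow_toReal hs hs_top, ← split_rpow _ (norm_nonneg _)]

theorem norm_toLp_le_card_rpow_mul (x : κ → ℝ) :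
    ‖WithLp.toLp r x‖ ≤
      (Fintype.card κ : ℝ) ^ max ((r⁻¹).toReal - (s⁻¹).toReal) 0 * ‖WithLp.toLp s x‖ := by
  have hr : r ≠ 0 := (zero_lt_one.trans_le Fact.out).ne'
  have hs : s ≠ 0 := (zero_lt_one.trans_le Fact.out).ne'
  rcases le_total s r with h | h
  · have inv_le := ENNReal.toReal_mono (ENNReal.inv_ne_top.2 hs) (ENNReal.inv_le_inv.2 h)
    rw [max_eq_right (sub_nonpos.2 inv_le), Real.rpow_zero, one_mul]
    exact norm_toLp_le_of_exponent_le h x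
  · have inv_le := ENNReal.toReal_mono (ENNReal.inv_ne_top.2 hr) (ENNReal.inv_le_inv.2 h)
    rw [max_eq_left (sub_nonneg.2 inv_le)]
    let _ : MeasurableSpace κ := ⊤
    have bound := eLpNorm_le_eLpNorm_mul_rpow_measure_univ (f := x) (μ := Measure.count) h
      measurable_from_top.aestronglyMeasurable
    rw [← enorm_toLp_eq_eLpNorm_count, ← enorm_toLp_eq_eLpNorm_count, Measure.count_univ] at bound
    have bound_real := ENNReal.toReal_mono (ENNReal.mul_ne_top (by simp)
      (ENNReal.rpow_ne_top_of_nonneg (by simpa using inv_le) (by simp))) bound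
    rw [ENNReal.toReal_mul, toReal_enorm, toReal_enorm, ← ENNReal.toReal_rpow] at bound_real
    simpa [mul_comm, ENNReal.toReal_inv] using bound_real

end LpNorm

/-- The closed unit ball of `ℓ_r`. -/
def lpBall (r : ℝ≥0∞) (κ : Type*) [Fintype κ] : Set (κ → ℝ) := {x | ‖WithLp.toLp r x‖ ≤ 1}

section LpBall

variable {κ : Type*} [Fintype κ] {r s : ℝ≥0∞}

theorem zero_mem_lpBall [Fact (1 ≤ r)] : (0 : κ → ℝ) ∈ lpBall r κ := by
  simp [lpBall]

theorem dotProduct_le_norm_toLp_of_mem_lpBall [ENNReal.HolderConjugate r s] {x : κ → ℝ}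
    (hx : x ∈ lpBall r κ) (v : κ → ℝ) : x ⬝ᵥ v ≤ ‖WithLp.toLp s v‖ := by
  have : Fact (1 ≤ s) := ⟨ENNReal.HolderConjugate.one_le s r⟩
  exact (dotProduct_le_norm_toLp_mul_norm_toLp x v).trans
    (mul_le_of_le_one_left (norm_nonneg _) hx)

theorem exists_mem_lpBall_dotProduct_eq_of_ne_top [hrs : ENNReal.HolderConjugate r s]
    (hr : r ≠ ∞) (hs : s ≠ ∞) {v : κ → ℝ} (hv : 0 ≤ v) :
    ∃ x ∈ lpBall r κ, x ⬝ᵥ v = ‖WithLp.toLp s v‖ := by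
  have conj : s.toReal.HolderConjugate r.toReal :=
    ENNReal.HolderConjugate.toReal_of_ne_top (hp := hs) (hq := hr)
  lift v to κ → NNReal using hv
  obtain ⟨w, hw, hwv⟩ := (NNReal.isGreatest_Lp Finset.univ v conj).1
  refine ⟨fun k => w k, ?_, ?_⟩
  · rw [lpBall, Set.mem_ofPred_eq, PiLp.norm_eq_sum conj.symm.pos]
    refine Real.rpow_le_one (Finset.sum_nonneg fun k _ => by positivity) ?_ (by positivity)
    simpa using NNReal.coe_le_coe.2 hw
  · rw [PiLp.norm_eq_sum conj.pos, dotProduct_comm]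
    simpa [dotProduct] using congrArg NNReal.toReal hwv

theorem exists_mem_lpBall_dotProduct_eq_of_nonneg [hrs : ENNReal.HolderConjugate r s]
    {v : κ → ℝ} (hv : 0 ≤ v) : ∃ x ∈ lpBall r κ, x ⬝ᵥ v = ‖WithLp.toLp s v‖ := by
  rcases eq_or_ne r ∞ with rfl | hr
  · obtain rfl : s = 1 := (ENNReal.HolderConjugate.eq_top_iff_eq_one ∞ s).1 rfl
    refine ⟨1, ?_, ?_⟩
    · rw [lpBall, Set.mem_ofPred_eq, PiLp.norm_toLp]
      exact (pi_norm_le_iff_of_nonneg zero_le_one).2 fun k => by simp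
    · simp [PiLp.norm_eq_of_L1, dotProduct, abs_of_nonneg (hv _)]
  rcases eq_or_ne s ∞ with rfl | hs
  · obtain rfl : r = 1 := (ENNReal.HolderConjugate.eq_top_iff_eq_one ∞ r).1 rfl
    classical
    rcases isEmpty_or_nonempty κ with _ | _
    · exact ⟨0, zero_mem_lpBall, by simp [Subsingleton.elim v 0]⟩
    obtain ⟨k, hk⟩ := Finite.exists_max v
    refine ⟨Pi.single k 1, ?_, ?_⟩
    · rw [lpBall, Set.mem_ofPred_eq, PiLp.toLp_single, PiLp.norm_single, norm_one]
    · rw [single_dotProduct, one_mul, PiLp.norm_toLp]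
      exact le_antisymm ((le_abs_self _).trans (norm_le_pi_norm v k))
        ((pi_norm_le_iff_of_nonneg (hv k)).2 fun j => (abs_of_nonneg (hv j)).trans_le (hk j))
  exact exists_mem_lpBall_dotProduct_eq_of_ne_top hr hs hv

theorem exists_mem_lpBall_dotProduct_eq [ENNReal.HolderConjugate r s] (v : κ → ℝ) :
    ∃ x ∈ lpBall r κ, x ⬝ᵥ v = ‖WithLp.toLp s v‖ := by
  have : Fact (1 ≤ r) := ⟨ENNReal.HolderConjugate.one_le r s⟩
  have : Fact (1 ≤ s) := ⟨ENNReal.HolderConjugate.one_le s r⟩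
  obtain ⟨w, hw, hwv⟩ := exists_mem_lpBall_dotProduct_eq_of_nonneg (r := r) (s := s) (abs_nonneg v)
  refine ⟨fun k => SignType.sign (v k) * w k, ?_, ?_⟩
  · refine (norm_toLp_le_of_abs_le fun k => ?_).trans hw
    rw [abs_mul]
    refine mul_le_of_le_one_left (abs_nonneg _) ?_
    rcases lt_trichotomy (v k) 0 with h | h | h <;> simp [h]
  · calc (fun k => SignType.sign (v k) * w k) ⬝ᵥ v = w ⬝ᵥ |v| :=
          Finset.sum_congr rfl fun k _ => by
            rw [Pi.abs_apply, ← sign_mul_self]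
            ring
      _ = ‖WithLp.toLp s |v|‖ := hwv
      _ = ‖WithLp.toLp s v‖ := le_antisymm
          (norm_toLp_le_of_abs_le fun k => (abs_abs (v k)).le)
          (norm_toLp_le_of_abs_le fun k => (abs_abs (v k)).ge)

theorem iSup_lpBall_dotProduct [ENNReal.HolderConjugate r s] (v : κ → ℝ) :
    ⨆ x : lpBall r κ, (x : κ → ℝ) ⬝ᵥ v = ‖WithLp.toLp s v‖ := by
  obtain ⟨x, hx, hxv⟩ := exists_mem_lpBall_dotProduct_eq (r := r) (s := s) v
  have greatest : IsGreatest (Set.range fun x : lpBall r κ => (x : κ → ℝ) ⬝ᵥ v)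
      ‖WithLp.toLp s v‖ :=
    ⟨⟨⟨x, hx⟩, hxv⟩, Set.forall_mem_range.2 fun x => dotProduct_le_norm_toLp_of_mem_lpBall x.2 v⟩
  exact greatest.csSup_eq

theorem dotProduct_self_eq_norm_toLp_two_sq (x : κ → ℝ) :
    x ⬝ᵥ x = ‖WithLp.toLp 2 x‖ ^ 2 := by
  rw [PiLp.norm_sq_eq_of_L2]
  exact Finset.sum_congr rfl fun k _ => by rw [Real.norm_eq_abs, sq_abs, sq]

variable [Fact (1 ≤ r)]

theorem dotProduct_self_le_of_mem_lpBall {x : κ → ℝ} (hx : x ∈ lpBall r κ) :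
    x ⬝ᵥ x ≤ ((Fintype.card κ : ℝ) ^ max (1 / 2 - (r⁻¹).toReal) 0) ^ 2 := by
  rw [dotProduct_self_eq_norm_toLp_two_sq]
  have norm_le := norm_toLp_le_card_rpow_mul (r := 2) (s := r) x
  rw [show ((2 : ℝ≥0∞)⁻¹).toReal = 1 / 2 by simp] at norm_le
  gcongr
  exact norm_le.trans (mul_le_of_le_one_right (by positivity) hx)

theorem exists_mem_lpBall_dotProduct_self_eq [Nonempty κ] : ∃ x ∈ lpBall r κ,
    x ⬝ᵥ x = ((Fintype.card κ : ℝ) ^ max (1 / 2 - (r⁻¹).toReal) 0) ^ 2 := by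
  classical
  have card_pos : (0 : ℝ) < Fintype.card κ := Nat.cast_pos.2 Fintype.card_pos
  rcases le_total (1 / 2 - (r⁻¹).toReal) 0 with h | h
  · refine ⟨Pi.single (Classical.arbitrary κ) 1, ?_, ?_⟩
    · rw [lpBall, Set.mem_ofPred_eq, PiLp.toLp_single, PiLp.norm_single, norm_one]
    · rw [max_eq_right h, Real.rpow_zero, one_pow, single_dotProduct, Pi.single_eq_same, one_mul]
  · refine ⟨Function.const κ ((Fintype.card κ : ℝ) ^ (-(r⁻¹).toReal)), ?_, ?_⟩
    · rw [lpBall, Set.mem_ofPred_eq, PiLp.norm_toLp_const', one_div,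
        Real.norm_of_nonneg (by positivity)]
      push_cast
      rw [← Real.rpow_add card_pos]
      simp
    · rw [max_eq_left h, dotProduct_self_eq_norm_toLp_two_sq, PiLp.norm_toLp_const',
        Real.norm_of_nonneg (by positivity), sub_eq_add_neg, Real.rpow_add card_pos]
      simp

end LpBall

/-- The mean `E ‖g‖_r` of the `ℓ_r`-norm of a standard Gaussian vector. -/
noncomputable def expectedLpNorm (r : ℝ≥0∞) (κ : Type*) [Fintype κ] : ℝ :=
  ∫ g, ‖WithLp.toLp r g‖ ∂stdGaussianPi κ

section EmpiricalMean

variable {κ α : Type*} [Fintype κ] [MeasurableSpace α] {ν : Measure α} [IsProbabilityMeasure ν]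
  {f : α → ℝ}

theorem memLp_empirical_mean (hf : MemLp f 2 ν) :
    MemLp (fun x : κ → α => (Fintype.card κ : ℝ)⁻¹ * ∑ k, f (x k)) 2 (Measure.pi fun _ => ν) :=
  (memLp_finsetSum _ fun k _ =>
    hf.comp_measurePreserving (measurePreserving_eval (fun _ : κ => ν) k)).const_mul _

theorem variance_empirical_mean [Nonempty κ] (hf : MemLp f 2 ν) :
    Var[fun x : κ → α => (Fintype.card κ : ℝ)⁻¹ * ∑ k, f (x k); Measure.pi fun _ => ν] =
      Var[f; ν] / Fintype.card κ := by
  have variance_sum := variance_sum_pi (μ := fun _ : κ => ν) fun _ => hf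
  have sum_eq : (∑ k, fun x : κ → α => f (x k)) = fun x => ∑ k, f (x k) := by
    ext x
    simp only [Finset.sum_apply]
  rw [sum_eq, Finset.sum_const, Finset.card_univ, nsmul_eq_mul] at variance_sum
  have card_ne_zero : (Fintype.card κ : ℝ) ≠ 0 := Nat.cast_ne_zero.2 Fintype.card_ne_zero
  rw [variance_const_mul, variance_sum, sq, mul_assoc, inv_mul_cancel_left₀ card_ne_zero,
    inv_mul_eq_div]

theorem integral_empirical_mean [Nonempty κ] (hf : Integrable f ν) :
    ∫ x : κ → α, (Fintype.card κ : ℝ)⁻¹ * ∑ k, f (x k) ∂Measure.pi (fun _ => ν) = ∫ x, f x ∂ν := by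
  have card_ne_zero : (Fintype.card κ : ℝ) ≠ 0 := Nat.cast_ne_zero.2 Fintype.card_ne_zero
  have integrable_eval : ∀ k : κ, Integrable (fun x : κ → α => f (x k)) (Measure.pi fun _ => ν) :=
    fun k => (measurePreserving_eval (fun _ : κ => ν) k).integrable_comp_of_integrable hf
  rw [integral_const_mul, integral_finsetSum _ fun k _ => integrable_eval k]
  simp only [integral_comp_eval (μ := fun _ : κ => ν) hf.aestronglyMeasurable, Finset.sum_const,
    Finset.card_univ, nsmul_eq_mul]
  rw [inv_mul_cancel_left₀ card_ne_zero]

theorem integral_abs_sub_integral_le_sqrt_variance (hf : MemLp f 2 ν) :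
    ∫ x, |f x - ∫ y, f y ∂ν| ∂ν ≤ √(Var[f; ν]) := by
  have memLp_dev : MemLp (fun x => |f x - ∫ y, f y ∂ν|) 2 ν := (hf.sub (memLp_const _)).abs
  refine Real.le_sqrt_of_sq_le ?_
  have variance_dev := variance_nonneg (fun x => |f x - ∫ y, f y ∂ν|) ν
  rw [variance_eq_sub memLp_dev] at variance_dev
  rw [variance_eq_integral hf.aemeasurable]
  simpa [sq_abs] using variance_dev

theorem integral_abs_empirical_mean_sub_le [Nonempty κ] (hf : MemLp f 2 ν) :
    ∫ x : κ → α, |(Fintype.card κ : ℝ)⁻¹ * ∑ k, f (x k) - ∫ y, f y ∂ν| ∂Measure.pi (fun _ => ν) ≤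
      √(Var[f; ν] / Fintype.card κ) := by
  have h := integral_abs_sub_integral_le_sqrt_variance (memLp_empirical_mean (κ := κ) hf)
  rwa [integral_empirical_mean (hf.integrable one_le_two), variance_empirical_mean hf] at h

end EmpiricalMean

section ExpectedLpNorm

theorem abs_rpow_sub_one_le {t a : ℝ} (ht : 0 ≤ t) (ha : 0 ≤ a) (ha_one : a ≤ 1) :
    |t ^ a - 1| ≤ |t - 1| := by
  rcases le_total t 1 with h | h
  · have le_rpow := Real.rpow_le_rpow_of_exponent_ge' ht h ha ha_one
    rw [Real.rpow_one] at le_rpow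
    rw [abs_sub_comm, abs_sub_comm t, abs_of_nonneg (sub_nonneg.2 h),
      abs_of_nonneg (sub_nonneg.2 (Real.rpow_le_one ht h ha))]
    exact sub_le_sub_left le_rpow 1
  · have rpow_le := Real.rpow_le_rpow_of_exponent_le h ha_one
    rw [Real.rpow_one] at rpow_le
    rw [abs_of_nonneg (sub_nonneg.2 h), abs_of_nonneg (sub_nonneg.2 (Real.one_le_rpow h ha))]
    exact sub_le_sub_right rpow_le 1

theorem abs_rpow_sub_rpow_le {t m a : ℝ} (ht : 0 ≤ t) (hm : 0 < m) (ha : 0 ≤ a) (ha_one : a ≤ 1) :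
    |t ^ a - m ^ a| ≤ m ^ a / m * |t - m| :=
  calc |t ^ a - m ^ a| = m ^ a * |(t / m) ^ a - 1| := by
        have rpow_pos := Real.rpow_pos_of_pos hm a
        rw [Real.div_rpow ht hm.le, div_sub_one rpow_pos.ne', abs_div, abs_of_pos rpow_pos,
          mul_div_cancel₀ _ rpow_pos.ne']
    _ ≤ m ^ a * |t / m - 1| := by
        gcongr 1
        exact abs_rpow_sub_one_le (by positivity) ha ha_one
    _ = m ^ a / m * |t - m| := by
        rw [div_sub_one hm.ne', abs_div, abs_of_pos hm]
        ring

theorem memLp_abs_rpow_gaussianReal {a : ℝ} (ha : 0 < a) :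
    MemLp (fun z : ℝ => |z| ^ a) 2 (gaussianReal 0 1) := by
  have h := (memLp_id_gaussianReal' (μ := 0) (v := 1) (2 * ENNReal.ofReal a)
    (ENNReal.mul_ne_top (by simp) (by simp))).norm_rpow_div (ENNReal.ofReal a)
  rwa [ENNReal.mul_div_cancel_right (by simpa using ha) (by simp),
    ENNReal.toReal_ofReal ha.le] at h

theorem integral_abs_rpow_gaussianReal_pos {a : ℝ} (ha : 0 < a) :
    0 < ∫ z : ℝ, |z| ^ a ∂gaussianReal 0 1 := by
  have : NullSingletonClass (gaussianReal 0 1) := nullSingletonClass_gaussianReal one_ne_zero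
  have support_eq : (Function.support fun z : ℝ => |z| ^ a) = {0}ᶜ := by
    ext z
    simp [Real.rpow_eq_zero_iff_of_nonneg (abs_nonneg z), ha.ne']
  rw [integral_pos_iff_support_of_nonneg (fun z => by positivity)
    ((memLp_abs_rpow_gaussianReal ha).integrable one_le_two), support_eq,
    prob_compl_eq_one_sub (measurableSet_singleton 0), measure_singleton]
  simp

variable {r : ℝ≥0∞} [Fact (1 ≤ r)]

theorem integrable_norm_toLp {κ : Type*} [Fintype κ] :
    Integrable (fun g : κ → ℝ => ‖WithLp.toLp r g‖) (stdGaussianPi κ) :=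
  ((PiLp.continuousLinearEquiv r ℝ fun _ : κ => ℝ).symm.toContinuousLinearMap.integrable_comp
    IsGaussian.integrable_id).norm

theorem card_rpow_neg_mul_norm_toLp {κ : Type*} [Fintype κ] (hr : r ≠ ∞) (g : κ → ℝ) :
    (Fintype.card κ : ℝ) ^ (-(r⁻¹).toReal) * ‖WithLp.toLp r g‖ =
      ((Fintype.card κ : ℝ)⁻¹ * ∑ k, |g k| ^ r.toReal) ^ (1 / r.toReal) := by
  have hr_pos := ENNReal.toReal_pos (zero_lt_one.trans_le (Fact.out : 1 ≤ r)).ne' hr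
  rw [Real.mul_rpow (by positivity) (by positivity), PiLp.norm_eq_sum hr_pos,
    Real.inv_rpow (by positivity), ← Real.rpow_neg (by positivity), ENNReal.toReal_inv, one_div]
  rfl

theorem abs_card_rpow_neg_mul_expectedLpNorm_sub_le {κ : Type*} [Fintype κ] [Nonempty κ]
    (hr : r ≠ ∞) :
    |(Fintype.card κ : ℝ) ^ (-(r⁻¹).toReal) * expectedLpNorm r κ - gaussianXi r| ≤
      gaussianXi r / (∫ z : ℝ, |z| ^ r.toReal ∂gaussianReal 0 1) *
        √(Var[fun z => |z| ^ r.toReal; gaussianReal 0 1] / Fintype.card κ) := by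
  have hr_one : 1 ≤ r.toReal := by simpa using ENNReal.toReal_mono hr (Fact.out : 1 ≤ r)
  have hr_pos : 0 < r.toReal := zero_lt_one.trans_le hr_one
  have memLp_pow := memLp_abs_rpow_gaussianReal hr_pos
  set m := ∫ z : ℝ, |z| ^ r.toReal ∂gaussianReal 0 1 with hm
  have m_pos : 0 < m := integral_abs_rpow_gaussianReal_pos hr_pos
  have ratio_nonneg : 0 ≤ gaussianXi r / m := by rw [gaussianXi]; positivity
  have integrable_norm := (integrable_norm_toLp (κ := κ) (r := r)).const_mul
    ((Fintype.card κ : ℝ) ^ (-(r⁻¹).toReal))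
  have integrable_mean :=
    ((memLp_empirical_mean (κ := κ) memLp_pow).integrable one_le_two).sub (integrable_const m)
  calc _ = |∫ g : κ → ℝ, ((Fintype.card κ : ℝ) ^ (-(r⁻¹).toReal) * ‖WithLp.toLp r g‖ -
            gaussianXi r) ∂stdGaussianPi κ| := by
        rw [integral_sub integrable_norm (integrable_const _), integral_const_mul]
        simp [expectedLpNorm]
    _ ≤ ∫ g : κ → ℝ, |(Fintype.card κ : ℝ) ^ (-(r⁻¹).toReal) * ‖WithLp.toLp r g‖ -
            gaussianXi r| ∂stdGaussianPi κ := abs_integral_le_integral_abs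
    _ ≤ ∫ g : κ → ℝ, gaussianXi r / m *
          |(Fintype.card κ : ℝ)⁻¹ * ∑ k, |g k| ^ r.toReal - m| ∂stdGaussianPi κ := by
        refine integral_mono (integrable_norm.sub (integrable_const _)).abs
          (integrable_mean.abs.const_mul _) fun g => ?_
        beta_reduce
        rw [card_rpow_neg_mul_norm_toLp hr, gaussianXi, ← hm]
        exact abs_rpow_sub_rpow_le (by positivity) m_pos (by positivity)
          ((div_le_one hr_pos).2 hr_one)
    _ ≤ _ := by
        rw [integral_const_mul]
        exact mul_le_mul_of_nonneg_left (integral_abs_empirical_mean_sub_le memLp_pow) ratio_nonneg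

theorem tendsto_rpow_neg_mul_expectedLpNorm (hr : r ≠ ∞) :
    Tendsto (fun n : ℕ => (n : ℝ) ^ (-(r⁻¹).toReal) * expectedLpNorm r (Fin n)) atTop
      (𝓝 (gaussianXi r)) := by
  set C := gaussianXi r / ∫ z : ℝ, |z| ^ r.toReal ∂gaussianReal 0 1
  set V := Var[fun z => |z| ^ r.toReal; gaussianReal 0 1]
  have error_tendsto : Tendsto (fun n : ℕ => C * √(V / n)) atTop (𝓝 0) := by
    simpa using ((tendsto_const_div_atTop_nhds_zero_nat V).sqrt).const_mul C
  refine tendsto_iff_norm_sub_tendsto_zero.2 (squeeze_zero' (.of_forall fun n => norm_nonneg _)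
    ?_ error_tendsto)
  filter_upwards [eventually_ne_atTop 0] with n hn
  have : NeZero n := ⟨hn⟩
  simpa using abs_card_rpow_neg_mul_expectedLpNorm_sub_le (κ := Fin n) hr

theorem exists_finite_exponent_le_inv_lt {e : ℝ} (he : (r⁻¹).toReal < e) :
    ∃ s : ℝ≥0∞, 1 ≤ s ∧ s ≠ ∞ ∧ s ≤ r ∧ (s⁻¹).toReal < e := by
  rcases eq_or_ne r ∞ with rfl | hr
  · have he_pos : 0 < e := by simpa using he
    refine ⟨ENNReal.ofReal (max 1 (2 / e)), ENNReal.one_le_ofReal.2 (le_max_left _ _), by simp,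
      le_top, ?_⟩
    rw [ENNReal.toReal_inv, ENNReal.toReal_ofReal (by positivity)]
    calc (max 1 (2 / e))⁻¹ ≤ (2 / e)⁻¹ := inv_anti₀ (by positivity) (le_max_right _ _)
      _ = e / 2 := inv_div _ _
      _ < e := half_lt_self he_pos
  · exact ⟨r, Fact.out, hr, le_rfl, he⟩

theorem expectedLpNorm_le_of_exponent_le {κ : Type*} [Fintype κ] {s : ℝ≥0∞} [Fact (1 ≤ s)]
    (hsr : s ≤ r) : expectedLpNorm r κ ≤ expectedLpNorm s κ :=
  integral_mono integrable_norm_toLp integrable_norm_toLp (norm_toLp_le_of_exponent_le hsr)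

theorem tendsto_rpow_neg_mul_expectedLpNorm_zero {e : ℝ} (he : (r⁻¹).toReal < e) :
    Tendsto (fun n : ℕ => (n : ℝ) ^ (-e) * expectedLpNorm r (Fin n)) atTop (𝓝 0) := by
  obtain ⟨s, hs_one, hs, hsr, hse⟩ := exists_finite_exponent_le_inv_lt he
  have : Fact (1 ≤ s) := ⟨hs_one⟩
  have bound_tendsto : Tendsto (fun n : ℕ => (n : ℝ) ^ (-(e - (s⁻¹).toReal)) *
      ((n : ℝ) ^ (-(s⁻¹).toReal) * expectedLpNorm s (Fin n))) atTop (𝓝 0) := by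
    simpa using ((tendsto_rpow_neg_atTop (sub_pos.2 hse)).comp
      tendsto_natCast_atTop_atTop).mul (tendsto_rpow_neg_mul_expectedLpNorm hs)
  refine squeeze_zero' (.of_forall fun n => mul_nonneg (by positivity)
    (integral_nonneg fun _ => norm_nonneg _)) ?_ bound_tendsto
  filter_upwards [eventually_gt_atTop 0] with n hn
  have exponent_eq : -(e - (s⁻¹).toReal) + -(s⁻¹).toReal = -e := by ring
  rw [← mul_assoc, ← Real.rpow_add (Nat.cast_pos.2 hn), exponent_eq]
  gcongr 1
  exact expectedLpNorm_le_of_exponent_le hsr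

end ExpectedLpNorm

/-- The width of the elementary tensors of two `ℓ`-balls: by duality, the mean norm of a `κ × ι`
standard Gaussian matrix from `ℓ_s` to the dual of `ℓ_r`. -/
noncomputable def lpTensorWidth (r s : ℝ≥0∞) (κ ι : Type*) [Fintype κ] [Fintype ι] : ℝ :=
  gaussianWidth fun i : lpBall r κ × lpBall s ι => tensorVec (i.1 : κ → ℝ) (i.2 : ι → ℝ)

section LpTensorWidth

variable {κ ι : Type*} [Fintype κ] [Fintype ι] {r r' s s' : ℝ≥0∞}

theorem gaussianWidth_lpBall [ENNReal.HolderConjugate r r'] :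
    gaussianWidth (fun y : lpBall r κ => (y : κ → ℝ)) = expectedLpNorm r' κ :=
  integral_congr_ae (.of_forall fun g => iSup_lpBall_dotProduct g)

theorem half_sub_toReal_inv [ENNReal.HolderConjugate r r'] :
    1 / 2 - (r⁻¹).toReal = (r'⁻¹).toReal - 1 / 2 := by
  have inv_ne_top : ∀ a b : ℝ≥0∞, [ENNReal.HolderConjugate a b] → a⁻¹ ≠ ∞ := fun a b _ =>
    ENNReal.inv_ne_top.2 (ENNReal.HolderConjugate.pos a b).ne'
  have sum_eq := congrArg ENNReal.toReal (ENNReal.HolderConjugate.inv_add_inv_eq_one r r')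
  rw [ENNReal.toReal_add (inv_ne_top r r') (inv_ne_top r' r), ENNReal.toReal_one] at sum_eq
  linarith

theorem isBounded_range_tensorVec_lpBall [Fact (1 ≤ r)] [Fact (1 ≤ s)] :
    Bornology.IsBounded (Set.range fun i : lpBall r κ × lpBall s ι =>
      tensorVec (i.1 : κ → ℝ) (i.2 : ι → ℝ)) :=
  isBounded_range_tensorVec (fun x => dotProduct_self_le_of_mem_lpBall x.2)
    fun y => dotProduct_self_le_of_mem_lpBall y.2

instance nonempty_lpBall [Fact (1 ≤ r)] : Nonempty (lpBall r κ) := ⟨⟨0, zero_mem_lpBall⟩⟩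

theorem lpTensorWidth_le [ENNReal.HolderConjugate r r'] [ENNReal.HolderConjugate s s'] :
    lpTensorWidth r s κ ι ≤
      (Fintype.card ι : ℝ) ^ max ((s'⁻¹).toReal - 1 / 2) 0 * expectedLpNorm r' κ +
        (Fintype.card κ : ℝ) ^ max ((r'⁻¹).toReal - 1 / 2) 0 * expectedLpNorm s' ι := by
  have : Fact (1 ≤ r) := ⟨ENNReal.HolderConjugate.one_le r r'⟩
  have : Fact (1 ≤ s) := ⟨ENNReal.HolderConjugate.one_le s s'⟩
  rw [← half_sub_toReal_inv (r := s), ← half_sub_toReal_inv (r := r),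
    ← gaussianWidth_lpBall (r := r), ← gaussianWidth_lpBall (r := s)]
  exact gaussianWidth_tensorVec_le (by positivity)
    (fun x => dotProduct_self_le_of_mem_lpBall x.2) (by positivity)
    (fun y => dotProduct_self_le_of_mem_lpBall y.2) ⟨⟨0, zero_mem_lpBall⟩, rfl⟩

theorem mul_expectedLpNorm_left_le_lpTensorWidth [Nonempty ι] [ENNReal.HolderConjugate r r']
    [ENNReal.HolderConjugate s s'] :
    (Fintype.card ι : ℝ) ^ max ((s'⁻¹).toReal - 1 / 2) 0 * expectedLpNorm r' κ ≤
      lpTensorWidth r s κ ι := by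
  have : Fact (1 ≤ r) := ⟨ENNReal.HolderConjugate.one_le r r'⟩
  have : Fact (1 ≤ s) := ⟨ENNReal.HolderConjugate.one_le s s'⟩
  obtain ⟨x, hx, hx_max⟩ := exists_mem_lpBall_dotProduct_self_eq (κ := ι) (r := s)
  rw [← half_sub_toReal_inv (r := s), ← gaussianWidth_lpBall (r := r)]
  exact mul_gaussianWidth_left_le (by positivity)
    (fun x => dotProduct_self_le_of_mem_lpBall x.2)
    (fun y => dotProduct_self_le_of_mem_lpBall y.2) ⟨⟨x, hx⟩, hx_max⟩

theorem mul_expectedLpNorm_right_le_lpTensorWidth [Nonempty κ] [ENNReal.HolderConjugate r r']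
    [ENNReal.HolderConjugate s s'] :
    (Fintype.card κ : ℝ) ^ max ((r'⁻¹).toReal - 1 / 2) 0 * expectedLpNorm s' ι ≤
      lpTensorWidth r s κ ι := by
  have : Fact (1 ≤ r) := ⟨ENNReal.HolderConjugate.one_le r r'⟩
  have : Fact (1 ≤ s) := ⟨ENNReal.HolderConjugate.one_le s s'⟩
  obtain ⟨y, hy, hy_max⟩ := exists_mem_lpBall_dotProduct_self_eq (κ := κ) (r := r)
  rw [← half_sub_toReal_inv (r := r), ← gaussianWidth_lpBall (r := s)]
  exact mul_gaussianWidth_right_le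
    (fun x => dotProduct_self_le_of_mem_lpBall x.2) (by positivity)
    (fun y => dotProduct_self_le_of_mem_lpBall y.2) ⟨⟨y, hy⟩, hy_max⟩

end LpTensorWidth

section OperatorNorm

variable {n : ℕ} {p q q' : ℝ≥0∞}

theorem dotProduct_mulVec_eq_tensorVec_dotProduct {κ ι : Type*} [Fintype κ] [Fintype ι]
    (A : Matrix κ ι ℝ) (y : κ → ℝ) (x : ι → ℝ) :
    y ⬝ᵥ A *ᵥ x = tensorVec y x ⬝ᵥ fun k => A k.1 k.2 := by
  simp only [dotProduct, Matrix.mulVec, tensorVec, Fintype.sum_prod_type, Finset.mul_sum]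
  exact Finset.sum_congr rfl fun i _ => Finset.sum_congr rfl fun j _ => by ring

theorem matrixOpNorm_eq_norm [Fact (1 ≤ p)] [Fact (1 ≤ q)] (A : Matrix (Fin n) (Fin n) ℝ) :
    matrixOpNorm p q A = ‖(Matrix.toLpLin p q A).toContinuousLinearMap‖ := by
  rw [← ContinuousLinearMap.sSup_sphere_eq_norm, matrixOpNorm, iSup]
  congr 1
  ext c
  simp [Matrix.toLpLin_apply]

theorem matrixOpNorm_eq_iSup [ENNReal.HolderConjugate q' q] [Fact (1 ≤ p)]
    (A : Matrix (Fin n) (Fin n) ℝ) :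
    matrixOpNorm p q A = ⨆ i : lpBall q' (Fin n) × lpBall p (Fin n),
      tensorVec (i.1 : Fin n → ℝ) (i.2 : Fin n → ℝ) ⬝ᵥ fun k => A k.1 k.2 := by
  have : Fact (1 ≤ q) := ⟨ENNReal.HolderConjugate.one_le q q'⟩
  have : Fact (1 ≤ q') := ⟨ENNReal.HolderConjugate.one_le q' q⟩
  have bdd := bddAbove_range_dotProduct
    (isBounded_range_tensorVec_lpBall (κ := Fin n) (ι := Fin n) (r := q') (s := p))
    fun k => A k.1 k.2
  rw [matrixOpNorm_eq_norm]
  refine le_antisymm ?_ (ciSup_le fun i => ?_)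
  · rw [← ContinuousLinearMap.sSup_unitClosedBall_eq_norm]
    refine csSup_le ((Metric.nonempty_closedBall.2 zero_le_one).image _)
      (Set.forall_mem_image.2 fun x hx => ?_)
    obtain ⟨y, hy, hyx⟩ :=
      exists_mem_lpBall_dotProduct_eq (r := q') (s := q) (A *ᵥ WithLp.ofLp x)
    refine hyx.symm.trans_le ?_
    rw [dotProduct_mulVec_eq_tensorVec_dotProduct]
    exact le_ciSup bdd (⟨y, hy⟩, ⟨WithLp.ofLp x, mem_closedBall_zero_iff.1 hx⟩)
  · rw [← dotProduct_mulVec_eq_tensorVec_dotProduct]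
    exact (dotProduct_le_norm_toLp_of_mem_lpBall i.1.2 _).trans
      ((Matrix.toLpLin p q A).toContinuousLinearMap.unit_le_opNorm
        (WithLp.toLp p (i.2 : Fin n → ℝ)) i.2.2)

end OperatorNorm

namespace IsStdGaussianMatrix

variable {n : ℕ} {Ω : Type*} [MeasurableSpace Ω] {G : Ω → Matrix (Fin n) (Fin n) ℝ}
  {P : Measure Ω} {p q q' : ℝ≥0∞} [Fact (1 ≤ p)]

theorem hasLaw_entries (h : IsStdGaussianMatrix G P) :
    HasLaw (fun ω (k : Fin n × Fin n) => G ω k.1 k.2) (stdGaussianPi (Fin n × Fin n)) P :=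
  iIndepFun.hasLaw_pi (fun k => h.hasLaw k.1 k.2) h.indep

theorem integrable_matrixOpNorm [Fact (1 ≤ q)] (h : IsStdGaussianMatrix G P) :
    Integrable (fun ω => matrixOpNorm p q (G ω)) P := by
  have : Fact (1 ≤ q.conjExponent) := ⟨ENNReal.HolderConjugate.one_le _ q⟩
  have integrable := integrable_iSup_dotProduct (isBounded_range_tensorVec_lpBall
    (κ := Fin n) (ι := Fin n) (r := q.conjExponent) (s := p))
  rw [← h.hasLaw_entries.map_eq] at integrable
  simp only [matrixOpNorm_eq_iSup (q' := q.conjExponent)]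
  exact integrable.comp_aemeasurable h.hasLaw_entries.aemeasurable

theorem integral_matrixOpNorm [ENNReal.HolderConjugate q' q] (h : IsStdGaussianMatrix G P) :
    ∫ ω, matrixOpNorm p q (G ω) ∂P = lpTensorWidth q' p (Fin n) (Fin n) := by
  have : Fact (1 ≤ q') := ⟨ENNReal.HolderConjugate.one_le q' q⟩
  simp only [matrixOpNorm_eq_iSup (q' := q')]
  exact h.hasLaw_entries.integral_comp
    (integrable_iSup_dotProduct isBounded_range_tensorVec_lpBall).aestronglyMeasurable

end IsStdGaussianMatrix

section Asymptotics

theorem chevetExponent_top_left (q : ℝ≥0∞) : chevetExponent ∞ q = (q⁻¹).toReal := by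
  simp [chevetExponent]

theorem chevetExponent_top_right_lt {q : ℝ≥0∞} (hq : q ≠ 0) (hq_top : q ≠ ∞) :
    chevetExponent q ∞ < (q⁻¹).toReal := by
  have inv_pos : 0 < (q⁻¹).toReal :=
    ENNReal.toReal_pos (ENNReal.inv_ne_zero.2 hq_top) (ENNReal.inv_ne_top.2 hq)
  simpa [chevetExponent] using inv_pos

theorem tendsto_rpow_neg_mul_of_le_of_le {r s : ℝ≥0∞} [Fact (1 ≤ r)] [Fact (1 ≤ s)]
    (hr : r ≠ ∞) (h : chevetExponent r s < chevetExponent s r) {E : ℕ → ℝ}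
    (h_lower : ∀ n : ℕ, n ≠ 0 →
      (n : ℝ) ^ max ((s⁻¹).toReal - 1 / 2) 0 * expectedLpNorm r (Fin n) ≤ E n)
    (h_upper : ∀ n : ℕ, n ≠ 0 → E n ≤
      (n : ℝ) ^ max ((s⁻¹).toReal - 1 / 2) 0 * expectedLpNorm r (Fin n) +
        (n : ℝ) ^ max ((r⁻¹).toReal - 1 / 2) 0 * expectedLpNorm s (Fin n)) :
    Tendsto (fun n : ℕ => (n : ℝ) ^ (-chevetExponent s r) * E n) atTop (𝓝 (gaussianXi r)) := by
  set α := max ((s⁻¹).toReal - 1 / 2) 0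
  set β := max ((r⁻¹).toReal - 1 / 2) 0
  set e := chevetExponent s r with he
  have rpow_alpha : ∀ n : ℕ, n ≠ 0 → (n : ℝ) ^ (-(r⁻¹).toReal) = (n : ℝ) ^ (-e) * (n : ℝ) ^ α := by
    intro n hn
    rw [← Real.rpow_add (Nat.cast_pos.2 (Nat.pos_of_ne_zero hn)), he, chevetExponent,
      neg_add_rev, neg_add_cancel_right]
  have rpow_beta : ∀ n : ℕ, n ≠ 0 → (n : ℝ) ^ (-(e - β)) = (n : ℝ) ^ (-e) * (n : ℝ) ^ β := by
    intro n hn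
    rw [← Real.rpow_add (Nat.cast_pos.2 (Nat.pos_of_ne_zero hn)), neg_sub, sub_eq_neg_add]
  have main_term := tendsto_rpow_neg_mul_expectedLpNorm hr
  have lower_order := tendsto_rpow_neg_mul_expectedLpNorm_zero (lt_sub_iff_add_lt'.2 h)
  refine tendsto_of_tendsto_of_tendsto_of_le_of_le' main_term
    (by simpa only [add_zero] using main_term.add lower_order) ?_ ?_ <;>
    filter_upwards [eventually_ne_atTop 0] with n hn
  · rw [rpow_alpha n hn, mul_assoc]
    exact mul_le_mul_of_nonneg_left (h_lower n hn) (by positivity)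
  · rw [rpow_alpha n hn, rpow_beta n hn, mul_assoc, mul_assoc, ← mul_add]
    exact mul_le_mul_of_nonneg_left (h_upper n hn) (by positivity)

variable {r r' s s' : ℝ≥0∞} [ENNReal.HolderConjugate r r'] [ENNReal.HolderConjugate s s']

theorem tendsto_lpTensorWidth_of_chevetExponent_lt (hr' : r' ≠ ∞)
    (h : chevetExponent r' s' < chevetExponent s' r') :
    Tendsto (fun n : ℕ => (n : ℝ) ^ (-chevetExponent s' r') * lpTensorWidth r s (Fin n) (Fin n))
      atTop (𝓝 (gaussianXi r')) := by
  have : Fact (1 ≤ r') := ⟨ENNReal.HolderConjugate.one_le r' r⟩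
  have : Fact (1 ≤ s') := ⟨ENNReal.HolderConjugate.one_le s' s⟩
  refine tendsto_rpow_neg_mul_of_le_of_le hr' h (fun n hn => ?_) fun n _ => ?_
  · have : NeZero n := ⟨hn⟩
    simpa only [Fintype.card_fin] using mul_expectedLpNorm_left_le_lpTensorWidth
      (κ := Fin n) (ι := Fin n) (r := r) (s := s)
  · simpa only [Fintype.card_fin] using lpTensorWidth_le (κ := Fin n) (ι := Fin n) (r := r) (s := s)

theorem tendsto_lpTensorWidth_of_chevetExponent_gt (hs' : s' ≠ ∞)
    (h : chevetExponent s' r' < chevetExponent r' s') :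
    Tendsto (fun n : ℕ => (n : ℝ) ^ (-chevetExponent r' s') * lpTensorWidth r s (Fin n) (Fin n))
      atTop (𝓝 (gaussianXi s')) := by
  have : Fact (1 ≤ r') := ⟨ENNReal.HolderConjugate.one_le r' r⟩
  have : Fact (1 ≤ s') := ⟨ENNReal.HolderConjugate.one_le s' s⟩
  refine tendsto_rpow_neg_mul_of_le_of_le hs' h (fun n hn => ?_) fun n _ => ?_
  · have : NeZero n := ⟨hn⟩
    simpa only [Fintype.card_fin] using mul_expectedLpNorm_right_le_lpTensorWidth
      (κ := Fin n) (ι := Fin n) (r := r) (s := s)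
  · rw [add_comm]
    simpa only [Fintype.card_fin] using lpTensorWidth_le (κ := Fin n) (ι := Fin n) (r := r) (s := s)

end Asymptotics

theorem proposition3p3 {Ω : ℕ → Type*} [∀ n, MeasurableSpace (Ω n)]
    (P : ∀ n, Measure (Ω n)) [∀ n, IsProbabilityMeasure (P n)]
    (G : ∀ n, Ω n → Matrix (Fin n) (Fin n) ℝ)
    (hG : ∀ n, IsStdGaussianMatrix (G n) (P n))
    (p p' q : ℝ≥0∞) (hp : 1 ≤ p) (hpp' : ENNReal.HolderConjugate p p') (hq : 1 ≤ q) :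
    (∀ n, Integrable (fun ω => matrixOpNorm p q (G n ω)) (P n)) ∧
    (p = 1 → q < ∞ →
      Tendsto (fun n : ℕ => (n : ℝ) ^ (-(q⁻¹).toReal) * ∫ ω, matrixOpNorm p q (G n ω) ∂(P n))
        atTop (𝓝 (gaussianXi q))) ∧
    (1 < p → q = ∞ →
      Tendsto (fun n : ℕ => (n : ℝ) ^ (-(p'⁻¹).toReal) * ∫ ω, matrixOpNorm p q (G n ω) ∂(P n))
        atTop (𝓝 (gaussianXi p'))) ∧
    (1 < p → q < ∞ → chevetExponent q p' ≠ chevetExponent p' q →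
      Tendsto (fun n : ℕ =>
          (n : ℝ) ^ (-max (chevetExponent q p') (chevetExponent p' q)) *
            ∫ ω, matrixOpNorm p q (G n ω) ∂(P n))
        atTop (𝓝 (if chevetExponent q p' > chevetExponent p' q
          then gaussianXi p' else gaussianXi q))) := by
  have : Fact (1 ≤ p) := ⟨hp⟩
  have : Fact (1 ≤ q) := ⟨hq⟩
  have p'_ne_zero : p' ≠ 0 := (ENNReal.HolderConjugate.pos p' p).ne'
  have p'_ne_top (h : 1 < p) : p' ≠ ∞ := ((ENNReal.HolderConjugate.lt_top_iff_one_lt p' p).2 h).ne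
  refine ⟨fun n => (hG n).integrable_matrixOpNorm, ?_⟩
  simp only [fun n => (hG n).integral_matrixOpNorm (p := p) (q := q) (q' := q.conjExponent)]
  refine ⟨fun hp_one hq_top => ?_, fun hp_one hq_top => ?_, fun hp_one hq_top hne => ?_⟩
  · obtain rfl : p' = ∞ := (ENNReal.HolderConjugate.eq_top_iff_eq_one p' p).2 hp_one
    rw [← chevetExponent_top_left q]
    refine tendsto_lpTensorWidth_of_chevetExponent_lt hq_top.ne ?_
    rw [chevetExponent_top_left]
    exact chevetExponent_top_right_lt (zero_lt_one.trans_le hq).ne' hq_top.ne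
  · subst hq_top
    rw [← chevetExponent_top_left p']
    refine tendsto_lpTensorWidth_of_chevetExponent_gt (p'_ne_top hp_one) ?_
    rw [chevetExponent_top_left]
    exact chevetExponent_top_right_lt p'_ne_zero (p'_ne_top hp_one)
  · rcases lt_or_gt_of_ne hne with h | h
    · rw [if_neg h.not_gt, max_eq_right h.le]
      exact tendsto_lpTensorWidth_of_chevetExponent_lt hq_top.ne h
    · rw [if_pos h, max_eq_left h.le]
      exact tendsto_lpTensorWidth_of_chevetExponent_gt (p'_ne_top hp_one) h
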